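/- **Setting.** Let $d_1,\dots,d_N\ge 1$, let $\mathcal H=\mathcal H_1\times\cdots\times\mathcal H_N$ with $\mathcal H_i=\{h_i\in\mathbb R^{d_i}: h_i\ge 0,\ \mathbf 1^\top h_i=1\}$, let $\mathcal C\subseteq\mathbb R^{m}$ be closed and convex, and let $\eta>0$. Consider $$\min_{y\in\mathcal C}F(y)=f(h^*(y),y),\qquad h^*(y)=\arg\min_{h\in\mathcal H}\ g^\eta(h,y),\qquad g^\eta(h,y)=g(h,y)+\eta\sum_{i,j}\big(h_{ij}\ln h_{ij}-h_{ij}\big).$$ Assume that $\inf_{\mathcal C}F>-\infty$ and, with Euclidean and spectral norms: * $f$ is differentiable at the points $z=(h,y)$ of $\mathcal H\times\mathcal C$, and on $\mathcal H\times\mathcal C$ its gradient $\nabla_z f$ is $L_f$-Lipschitz and bounded in norm by $\Omega_f$; * $g(\cdot,y)$ is convex on $\mathcal H$ for each $y\in\mathcal C$; near every point of $\mathcal H\times\mathcal C$ the partial gradient $\nabla_h g$ exists and is continuously differentiable in $(h,y)$; for each $y\in\mathcal C$, on $\mathcal H$, $\nabla_h g(\cdot,y)$ is $L_g$-Lipschitz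 with $\|\nabla_h g\|\le\Omega_g$, $\nabla_y\nabla_h g(\cdot,y)$ is $\tau_g^h$-Lipschitz, $\nabla_h^2 g(\cdot,y)$ is $\rho_g^h$-Lipschitz, $\|\nabla_h^2 g\|\le L_g$ and $\|\nabla_y\nabla_h g\|\le\Lambda_g^{yh}$; for each $h\in\mathcal H$, on $\mathcal C$, $\nabla_y\nabla_h g(h,\cdot)$ is $\tau_g^y$-Lipschitz and $\nabla_h^2 g(h,\cdot)$ is $\rho_g^y$-Lipschitz. **Algorithm** (constant step sizes $\alpha,\beta$; $D$ inner steps). Start from $y^0\in\mathcal C$ and $h^{0,0}=h^0$ with $\mathbf 1^\top h^0_i=1$ and $h^0_{ij}\ge\nu^{\min}:=e^{-2\Omega_g/\eta}/\max_i d_i$ for all $i,j$. For $k=0,1,2,\dots$ put $h^{k,0}=h^{k-1,D}$ if $k>0$, and $\mathsf R_{k,0}=0$; for $t=0,\dots,D-1$ put $$h_i^{k,t+1}=\frac{h_i^{k,t}\circ\exp\!\big(-\alpha\nabla_{h_i}g^\eta(h^{k,t},y^k)\big)}{(h_i^{k,t})^\top\exp\!\big(-\alpha\nabla_{h_i}g^\eta(h^{k,t},y^k)\big)}\quad(1\le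 i\le N),$$ $$\mathsf R_{k,t+1}=B\big[(1-\eta\alpha)\,\mathrm{diag}(1/h^{k,t})-\alpha\nabla_h^2 g(h^{k,t},y^k)\big]\mathsf R_{k,t}-\alpha B\,\nabla_y\nabla_h g(h^{k,t},y^k),$$ where $B$ is block diagonal with blocks $\mathrm{diag}(h_i^{k,t+1})-h_i^{k,t+1}(h_i^{k,t+1})^\top$ (this is the derivative of the first recursion with respect to $y^k$); then put $$y^{k+1}=\mathrm{Proj}_{\mathcal C}\Big(y^k-\beta\big[\nabla_y f(h^{k,D},y^k)+\mathsf R_{k,D}^\top\nabla_h f(h^{k,D},y^k)\big]\Big).$$ **Theorem.** There is a function $\lambda(\eta,\alpha)\in(0,1)$ such that, for every problem as above, $F$ is differentiable at every point of $\mathcal C$ and there exist constants $\overline\alpha>0$ and $0<\underline\beta<\overline\beta$ with the following property. For each $0<\alpha\le\overline\alpha$ there are $D^0=D^0(\eta,\alpha)$ and $c_2$ (which may depend on the problem data, but not on $y^0,h^0,\beta,D,K$), and for each $y^0\in\mathcal C$ a constant $c_1$ (which may depend also on $y^0$, but not on $h^0,\beta,D,K$), such that for all admissible $h^0$, all $\beta\in[\underline\beta,\overline\beta]$,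 all $D\ge D^0$ and all $K\ge 1$, $$\frac1K\sum_{k=1}^{K}\mathrm{dist}^2\big(-\nabla F(y^k),N_{\mathcal C}(y^k)\big)\ \le\ \frac{c_1}{K}+c_2\,\lambda(\eta,\alpha)^D,$$ where $N_{\mathcal C}(y)=\{p\in\mathbb R^m:\langle p,y'-y\rangle\le 0\ \ \forall y'\in\mathcal C\}$ is the normal cone to $\mathcal C$ at $y$. -/

import Mathlib

open scoped BigOperators Topology

noncomputable section

namespace BilevelPMD

/-- The space of lower-level variables `h = (h_i)_i`, `h_i ∈ ℝ^{d i}`, with the Euclidean norm. -/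
abbrev Lower {N : ℕ} (d : Fin N → ℕ) : Type := EuclideanSpace ℝ ((i : Fin N) × Fin (d i))

/-- The space of upper-level variables. -/
abbrev Upper (m : ℕ) : Type := EuclideanSpace ℝ (Fin m)

variable {N : ℕ} {d : Fin N → ℕ} {m : ℕ}

/-! ### The constraint sets -/

/-- The product of simplices `ℋ = ℋ_1 × ⋯ × ℋ_N`. -/
def simplices (d : Fin N → ℕ) : Set (Lower d) :=
  {h | (∀ p, 0 ≤ h p) ∧ ∀ i, ∑ j : Fin (d i), h ⟨i, j⟩ = 1}

/-- `ν_min = exp (-2 Ω_g / η) / max_i d_i`. -/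
def nuMin (d : Fin N → ℕ) (Ωg η : ℝ) : ℝ :=
  Real.exp (-(2 * Ωg / η)) / ((Finset.univ.sup d : ℕ) : ℝ)

/-- The set of admissible initial points: all entries are at least `ν_min`. -/
def innerSimplices (d : Fin N → ℕ) (Ωg η : ℝ) : Set (Lower d) :=
  {h | (∀ p, nuMin d Ωg η ≤ h p) ∧ ∀ i, ∑ j : Fin (d i), h ⟨i, j⟩ = 1}

/-- The normal cone of `C` at `y`. -/
def normalCone (C : Set (Upper m)) (y : Upper m) : Set (Upper m) :=
  {p | ∀ y' ∈ C, inner ℝ p (y' - y) ≤ 0}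

/-- The Euclidean projection onto `C` (a nearest point of `C`). -/
def proj (C : Set (Upper m)) (x : Upper m) : Upper m :=
  Classical.epsilon fun p => p ∈ C ∧ ∀ w ∈ C, dist x p ≤ dist x w

/-! ### Derivatives of the objectives -/

/-- The full gradient `∇_z f (z)` at `z = (h, y)`, in the Euclidean product space. -/
def gradZ (f : Lower d → Upper m → ℝ) (h : Lower d) (y : Upper m) :
    WithLp 2 (Lower d × Upper m) :=
  gradient (fun z : WithLp 2 (Lower d × Upper m) => f z.fst z.snd) (WithLp.toLp 2 (h, y))

/-- The partial gradient `∇_h g (h, y)`. -/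
def gradH (g : Lower d → Upper m → ℝ) (h : Lower d) (y : Upper m) : Lower d :=
  gradient (fun h' => g h' y) h

/-- The Hessian `∇_h² g (h, y)`. -/
def hessH (g : Lower d → Upper m → ℝ) (h : Lower d) (y : Upper m) : Lower d →L[ℝ] Lower d :=
  fderiv ℝ (fun h' => gradH g h' y) h

/-- The cross Hessian `∇_y ∇_h g (h, y)`. -/
def crossHess (g : Lower d → Upper m → ℝ) (h : Lower d) (y : Upper m) : Upper m →L[ℝ] Lower d :=
  fderiv ℝ (fun y' => gradH g h y') y

/-! ### The bilevel problem -/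

/-- The negative Shannon entropy `∑ (h_{ij} ln h_{ij} - h_{ij})`. -/
def entropy (h : Lower d) : ℝ := ∑ p, (h p * Real.log (h p) - h p)

/-- The regularized lower-level objective `g^η = g + η ψ`. -/
def gReg (g : Lower d → Upper m → ℝ) (η : ℝ) (h : Lower d) (y : Upper m) : ℝ :=
  g h y + η * entropy h

/-- The lower-level solution `h^*(y)`, a minimizer of `g^η(·, y)` over `ℋ`. -/
def lowerSol (g : Lower d → Upper m → ℝ) (η : ℝ) (y : Upper m) : Lower d :=
  Classical.epsilon fun h => h ∈ simplices d ∧ IsMinOn (fun h' => gReg g η h' y) (simplices d) h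

/-- The bilevel objective `F(y) = f (h^*(y), y)`. -/
def objective (f g : Lower d → Upper m → ℝ) (η : ℝ) (y : Upper m) : ℝ := f (lowerSol g η y) y

/-- Assumptions on the upper-level objective: differentiability, with a Lipschitz and
bounded gradient on `ℋ × C`. -/
structure UpperAssumptions (f : Lower d → Upper m → ℝ) (C : Set (Upper m)) (Lf Ωf : ℝ) :
    Prop where
  differentiable : ∀ h ∈ simplices d, ∀ y ∈ C, DifferentiableAt ℝ
    (fun z : WithLp 2 (Lower d × Upper m) => f z.fst z.snd) (WithLp.toLp 2 (h, y))
  lipschitz_grad : ∀ h ∈ simplices d, ∀ y ∈ C, ∀ h' ∈ simplices d, ∀ y' ∈ C,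
    ‖gradZ f h y - gradZ f h' y'‖ ≤
      Lf * ‖(WithLp.toLp 2 (h, y) - WithLp.toLp 2 (h', y') : WithLp 2 (Lower d × Upper m))‖
  bounded_grad : ∀ h ∈ simplices d, ∀ y ∈ C, ‖gradZ f h y‖ ≤ Ωf

/-- Assumptions on the lower-level objective: convexity in `h`; existence of `∇_h g` and of
its continuous first derivatives near `ℋ × C`; and the Lipschitz and boundedness conditions
on `ℋ × C`. -/
structure LowerAssumptions (g : Lower d → Upper m → ℝ) (C : Set (Upper m))
    (Lg Ωg τh ρh Λ τy ρy : ℝ) : Prop where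
  convex : ∀ y ∈ C, ConvexOn ℝ (simplices d) (fun h => g h y)
  differentiable : ∀ h ∈ simplices d, ∀ y ∈ C, ∀ᶠ z in 𝓝 (h, y),
    DifferentiableAt ℝ (fun h' => g h' z.2) z.1
  contDiff_grad : ∀ h ∈ simplices d, ∀ y ∈ C,
    ContDiffAt ℝ 1 (fun z : Lower d × Upper m => gradH g z.1 z.2) (h, y)
  lipschitz_grad : ∀ y ∈ C, ∀ h ∈ simplices d, ∀ h' ∈ simplices d,
    ‖gradH g h y - gradH g h' y‖ ≤ Lg * ‖h - h'‖
  bounded_grad : ∀ y ∈ C, ∀ h ∈ simplices d, ‖gradH g h y‖ ≤ Ωg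
  lipschitz_cross_h : ∀ y ∈ C, ∀ h ∈ simplices d, ∀ h' ∈ simplices d,
    ‖crossHess g h y - crossHess g h' y‖ ≤ τh * ‖h - h'‖
  lipschitz_hess_h : ∀ y ∈ C, ∀ h ∈ simplices d, ∀ h' ∈ simplices d,
    ‖hessH g h y - hessH g h' y‖ ≤ ρh * ‖h - h'‖
  bounded_hess : ∀ y ∈ C, ∀ h ∈ simplices d, ‖hessH g h y‖ ≤ Lg
  bounded_cross : ∀ y ∈ C, ∀ h ∈ simplices d, ‖crossHess g h y‖ ≤ Λ
  lipschitz_cross_y : ∀ h ∈ simplices d, ∀ y ∈ C, ∀ y' ∈ C,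
    ‖crossHess g h y - crossHess g h y'‖ ≤ τy * ‖y - y'‖
  lipschitz_hess_y : ∀ h ∈ simplices d, ∀ y ∈ C, ∀ y' ∈ C,
    ‖hessH g h y - hessH g h y'‖ ≤ ρy * ‖y - y'‖

/-! ### The algorithm -/

/-- The mirror-descent step on the product of simplices with respect to the KL divergence:
`h_i ∘ exp (-α ∇_{h_i} g^η) / (h_iᵀ exp (-α ∇_{h_i} g^η))` for every `i`. -/
def pmdStep (g : Lower d → Upper m → ℝ) (η α : ℝ) (y : Upper m) (h : Lower d) : Lower d :=
  WithLp.toLp 2 fun p =>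
    h p * Real.exp (-α * gradH (gReg g η) h y p) /
      ∑ j : Fin (d p.1), h ⟨p.1, j⟩ * Real.exp (-α * gradH (gReg g η) h y ⟨p.1, j⟩)

/-- `B(h)`, the block-diagonal matrix with blocks `diag h_i - h_i h_iᵀ`. -/
def blockB (h : Lower d) : Lower d →L[ℝ] Lower d :=
  Matrix.toEuclideanCLM (𝕜 := ℝ) <| Matrix.blockDiagonal' fun i =>
    Matrix.diagonal (fun j : Fin (d i) => h ⟨i, j⟩) -
      Matrix.vecMulVec (fun j : Fin (d i) => h ⟨i, j⟩) (fun j : Fin (d i) => h ⟨i, j⟩)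

/-- `diag (1 / h)`. -/
def diagInv (h : Lower d) : Lower d →L[ℝ] Lower d :=
  Matrix.toEuclideanCLM (𝕜 := ℝ) <| Matrix.diagonal fun p => 1 / h p

/-- The Jacobian step `Φ(R, h, h⁺, y) = M R + U` that differentiates the mirror-descent step
`h ↦ h⁺` with respect to `y`, with
`M = B(h⁺) [(1 - η α) diag (1 / h) - α ∇_h² g (h, y)]` and `U = -α B(h⁺) ∇_y ∇_h g (h, y)`. -/
def jacStep (g : Lower d → Upper m → ℝ) (η α : ℝ) (y : Upper m) (h hnext : Lower d)
    (R : Upper m →L[ℝ] Lower d) : Upper m →L[ℝ] Lower d :=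
  (blockB hnext ∘L ((1 - η * α) • diagInv h - α • hessH g h y)) ∘L R +
    (-α) • (blockB hnext ∘L crossHess g h y)

/-- The inner loop for fixed `y`, started at `(h0, 0)`: the pair `(h^t, R_t)` after `t` steps. -/
def lowerIter (g : Lower d → Upper m → ℝ) (η α : ℝ) (y : Upper m) (h0 : Lower d) :
    ℕ → Lower d × (Upper m →L[ℝ] Lower d)
  | 0 => (h0, 0)
  | t + 1 =>
    let s := lowerIter g η α y h0 t
    (pmdStep g η α y s.1, jacStep g η α y s.1 (pmdStep g η α y s.1) s.2)

/-- The gradient estimator `∇_y f (h, y) + Rᵀ ∇_h f (h, y)`. -/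
def hyperGrad (f : Lower d → Upper m → ℝ) (h : Lower d) (R : Upper m →L[ℝ] Lower d)
    (y : Upper m) : Upper m :=
  (gradZ f h y).snd + ContinuousLinearMap.adjoint R (gradZ f h y).fst

/-- The outer loop with constant step sizes `α`, `β` and `D` inner iterations per outer
iteration: the pair `(y^k, h^{k,0})`. -/
def upperIter (f g : Lower d → Upper m → ℝ) (C : Set (Upper m)) (η α β : ℝ) (D : ℕ)
    (y0 : Upper m) (h0 : Lower d) : ℕ → Upper m × Lower d
  | 0 => (y0, h0)
  | k + 1 =>
    let s := upperIter f g C η α β D y0 h0 k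
    let q := lowerIter g η α s.1 s.2 D
    (proj C (s.1 - β • hyperGrad f q.1 q.2 s.1), q.1)

end BilevelPMD

end

/-!
The analysis is that of projected gradient descent on `F` with an inexact gradient, where the
inexactness is the error of the inner loop and is of order `√(1 - η α / 2) ^ D`, uniformly in the
outer iteration.

**The solution map.** The entropy pushes every minimizer of `g^η(·, y)` into the relative interior
(`pos_of_isMinOn`), so minimizers are the stationary points, equivalently the fixed points of
`h ↦ gibbs (-η⁻¹ ∇_h g (h, y))`. Over `C` the convexity of `g` makes them unique, compactness makes
the solution map continuous at the points of `C`, and linearizing the fixed-point equation makes it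
differentiable there (`hasFDerivAt_of_implicit`). For parameters near `C` but outside of it convexity
may fail, which is harmless: only existence and the fixed-point equation are used there. The
derivative `R` takes values in the tangent space of the simplices and is characterized by testing
`η diag (1 / h) R + ∇_h² g R + ∇_y ∇_h g` against tangent vectors (`IsSensitivity`). Since
`diag (1 / h) ≥ 1` and the Hessian is positive semidefinite on the tangent space, this weak form
bounds `R` by `Λ / η` and gives its Lipschitz continuity, hence that of `∇F`.

**The inner iterates.** Mirror descent preserves a bound on the logarithmic ratios within each block
(`core`), so all entries stay bounded away from zero. The three-point identity for the
Kullback-Leibler divergence gives the contraction factor `1 - η α` per step (`klDiv_pmdStep_le`).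

**The Jacobians.** In weak form `B(h⁺)` cancels against `diag (1 / h⁺)`, and in the norm weighted by
`1 / h^*` the error obeys a recursion with linear rate `1 - η α`, by the Cauchy-Schwarz inequality
for the positive semidefinite form `(1 - η α) diag (1 / h^*) - α ∇_h² g`
(`inner_contraction`). The perturbation is proportional to `‖h^t - h^*‖ (1 + ‖R_t‖)`, which decays
like `√(1 - η α) ^ t`, and is absorbed by the slightly slower rate `√(1 - η α / 2)`
(`exists_le_pow_of_perturbed_recursion`).

**The outer loop.** `infDist_normalCone_sq_le` bounds the squared stationarity measure at the new
iterate by the decrease of `F` plus the squared error, and the decreases telescope.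
-/

namespace BilevelPMD

open Filter
open scoped RealInnerProductSpace

/-! ### Convexity and second-order facts in inner product spaces -/

section General

variable {E : Type*} [NormedAddCommGroup E] [InnerProductSpace ℝ E]

lemma convexOn_hasFDerivAt_le {s : Set E} {f : E → ℝ} (hf : ConvexOn ℝ s f) {x y : E}
    {f' : E →L[ℝ] ℝ} (hx : x ∈ s) (hy : y ∈ s) (hd : HasFDerivAt f f' x) :
    f' (y - x) ≤ f y - f x := by
  have h1 := hf.comp_affineMap (AffineMap.lineMap x y : ℝ →ᵃ[ℝ] E)
  have h2 : HasDerivAt (f ∘ (AffineMap.lineMap x y : ℝ →ᵃ[ℝ] E)) (f' (y - x)) 0 := by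
    have h3 : HasFDerivAt f f' ((AffineMap.lineMap x y : ℝ →ᵃ[ℝ] E) 0) := by simpa using hd
    exact h3.comp_hasDerivAt (0 : ℝ) AffineMap.hasDerivAt_lineMap
  have := h1.le_slope_of_hasDerivAt (x := 0) (y := 1) (by simpa using hx) (by simpa using hy)
    one_pos h2
  simpa [slope] using this

/-- A first-order Taylor bound. The constant `L` instead of `L / 2` comes directly from the
mean value theorem. -/
lemma abs_sub_sub_inner_le {s : Set E} (hs : Convex ℝ s) {f : E → ℝ} {f' : E → E →L[ℝ] ℝ}
    {L : ℝ} (hL : 0 ≤ L) (hd : ∀ x ∈ s, HasFDerivAt f (f' x) x)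
    (hlip : ∀ x ∈ s, ∀ y ∈ s, ‖f' x - f' y‖ ≤ L * ‖x - y‖) {x y : E} (hx : x ∈ s) (hy : y ∈ s) :
    |f y - f x - f' x (y - x)| ≤ L * ‖y - x‖ ^ 2 := by
  obtain ⟨z, hz, hzeq⟩ := domain_mvt (fun x hx => (hd x hx).hasFDerivWithinAt) hs hx hy
  have hzs := hs.segment_subset hx hy hz
  have hzx : ‖z - x‖ ≤ ‖y - x‖ := by
    obtain ⟨t, ht, rfl⟩ := (segment_eq_image' ℝ x y ▸ hz)
    simp only [add_sub_cancel_left, norm_smul, Real.norm_eq_abs, abs_of_nonneg ht.1]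
    exact mul_le_of_le_one_left (norm_nonneg _) ht.2
  rw [hzeq, ← sub_apply]
  calc |(f' z - f' x) (y - x)| ≤ ‖f' z - f' x‖ * ‖y - x‖ := (f' z - f' x).le_opNorm _
    _ ≤ (L * ‖y - x‖) * ‖y - x‖ := by
        gcongr
        exact (hlip z hzs x hx).trans (by gcongr)
    _ = L * ‖y - x‖ ^ 2 := by ring

/-- The Cauchy-Schwarz inequality for a symmetric operator that is positive on a subspace. -/
lemma inner_map_sq_le (S : Submodule ℝ E) (A : E →L[ℝ] E)
    (hsymm : ∀ x y, ⟪x, A y⟫ = ⟪y, A x⟫) (hpos : ∀ x ∈ S, 0 ≤ ⟪x, A x⟫) {x y : E}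
    (hx : x ∈ S) (hy : y ∈ S) : ⟪x, A y⟫ ^ 2 ≤ ⟪x, A x⟫ * ⟪y, A y⟫ := by
  let B : LinearMap.BilinForm ℝ S :=
    LinearMap.compl₁₂ (innerₗ E) S.subtype (A.toLinearMap ∘ₗ S.subtype)
  have := LinearMap.BilinForm.apply_mul_apply_le_of_forall_zero_le B
    (fun x => hpos x x.2) ⟨x, hx⟩ ⟨y, hy⟩
  have h2 : ⟪x, A y⟫ * ⟪y, A x⟫ ≤ ⟪x, A x⟫ * ⟪y, A y⟫ := this
  rwa [← hsymm x y, ← sq] at h2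

end General

/-! ### The tangent space of the product of simplices -/

variable {N : ℕ} {d : Fin N → ℕ} {m : ℕ}

/-- The tangent space of `simplices d`: the entries of every block sum to zero. -/
def tangent (d : Fin N → ℕ) : Submodule ℝ (Lower d) where
  carrier := {v | ∀ i, ∑ j : Fin (d i), v ⟨i, j⟩ = 0}
  add_mem' := fun {a b} ha hb i => by
    simp [Finset.sum_add_distrib, ha i, hb i]
  zero_mem' := fun i => by simp
  smul_mem' := fun c a ha i => by
    simp [← Finset.mul_sum, ha i]

lemma inner_eq_sum (v w : Lower d) : ⟪v, w⟫ = ∑ p, v p * w p := by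
  simp [PiLp.inner_apply, mul_comm]

/-- Vectors that are constant on every block are orthogonal to the tangent space. -/
lemma inner_eq_zero_of_blockConst {v w : Lower d} (hv : v ∈ tangent d) {c : Fin N → ℝ}
    (hw : ∀ p, w p = c p.1) : ⟪v, w⟫ = 0 := by
  rw [inner_eq_sum, Fintype.sum_sigma]
  refine Finset.sum_eq_zero fun i _ => ?_
  simp_rw [hw, ← Finset.sum_mul, hv i, zero_mul]

lemma sub_mem_tangent {h h' : Lower d} (hh : h ∈ simplices d) (hh' : h' ∈ simplices d) :
    h - h' ∈ tangent d := fun i => by simp [hh.2 i, hh'.2 i]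

lemma norm_le_of_forall_abs_le {v w : Lower d} {c : ℝ} (hc : 0 ≤ c)
    (h : ∀ p, |w p| ≤ c * |v p|) : ‖w‖ ≤ c * ‖v‖ := by
  refine le_of_sq_le_sq ?_ (by positivity)
  rw [mul_pow, EuclideanSpace.real_norm_sq_eq, EuclideanSpace.real_norm_sq_eq, Finset.mul_sum]
  refine Finset.sum_le_sum fun p _ => ?_
  rw [← sq_abs (w p), ← sq_abs (v p), ← mul_pow]
  exact pow_le_pow_left₀ (abs_nonneg _) (h p) 2

lemma abs_apply_le_norm (v : Lower d) (p) : |v p| ≤ ‖v‖ := by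
  simpa using PiLp.norm_apply_le v p

@[simp] lemma diagInv_apply (h v : Lower d) (p) : diagInv h v p = v p / h p := by
  simp [diagInv, Matrix.mulVec_diagonal, div_eq_inv_mul]

lemma blockB_apply (h v : Lower d) (p) :
    blockB h v p = h p * (v p - ∑ j : Fin (d p.1), h ⟨p.1, j⟩ * v ⟨p.1, j⟩) := by
  obtain ⟨i, j⟩ := p
  simp only [blockB, Matrix.ofLp_toEuclideanCLM, Matrix.mulVec, dotProduct]
  rw [Fintype.sum_sigma, Finset.sum_eq_single i]
  · simp only [Matrix.blockDiagonal'_apply_eq, Matrix.sub_apply, Matrix.diagonal_apply,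
      Matrix.vecMulVec_apply, sub_mul, Finset.sum_sub_distrib, ite_mul, zero_mul,
      Finset.sum_ite_eq, Finset.mem_univ, if_true, mul_sub, Finset.mul_sum, mul_assoc]
  · intro k _ hk
    refine Finset.sum_eq_zero fun l _ => ?_
    rw [Matrix.blockDiagonal'_apply_ne _ _ _ (Ne.symm hk), zero_mul]
  · simp

lemma blockB_mem_tangent {h : Lower d} (hh : ∀ i, ∑ j : Fin (d i), h ⟨i, j⟩ = 1) (v : Lower d) :
    blockB h v ∈ tangent d := fun i => by
  have this (j) : blockB h v ⟨i, j⟩ =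
      h ⟨i, j⟩ * v ⟨i, j⟩ - h ⟨i, j⟩ * ∑ k : Fin (d i), h ⟨i, k⟩ * v ⟨i, k⟩ := by
    rw [blockB_apply, mul_sub]
  simp_rw [this, Finset.sum_sub_distrib, ← Finset.sum_mul, hh i, one_mul, sub_self]

/-- On tangent vectors, `diag (1 / h)` inverts `B(h)`. -/
lemma inner_diagInv_blockB {h : Lower d} (hh : ∀ p, 0 < h p) {e : Lower d} (he : e ∈ tangent d)
    (v : Lower d) : ⟪e, diagInv h (blockB h v)⟫ = ⟪e, v⟫ := by
  have : ⟪e, diagInv h (blockB h v) - v⟫ = 0 :=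
    inner_eq_zero_of_blockConst he (c := fun i => -∑ j : Fin (d i), h ⟨i, j⟩ * v ⟨i, j⟩)
      fun p => by
        have := (hh p).ne'
        simp only [PiLp.sub_apply, diagInv_apply, blockB_apply]
        field_simp
        ring
  rwa [inner_sub_right, sub_eq_zero] at this

lemma le_one_of_mem_simplices {h : Lower d} (hh : h ∈ simplices d) (p) : h p ≤ 1 := by
  obtain ⟨i, j⟩ := p
  rw [← hh.2 i]
  exact Finset.single_le_sum (f := fun j => h ⟨i, j⟩) (fun j _ => hh.1 _) (Finset.mem_univ j)

lemma convex_simplices (d : Fin N → ℕ) : Convex ℝ (simplices d) := by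
  intro x hx y hy a b ha hb hab
  refine ⟨fun p => ?_, fun i => ?_⟩
  · have := hx.1 p
    have := hy.1 p
    simp only [PiLp.add_apply, PiLp.smul_apply, smul_eq_mul]
    positivity
  · simp [Finset.sum_add_distrib, ← Finset.mul_sum, hx.2 i, hy.2 i, hab]

lemma isCompact_simplices (d : Fin N → ℕ) : IsCompact (simplices d) := by
  have hc : IsClosed (simplices d) := by
    have : simplices d = (⋂ p, {h : Lower d | 0 ≤ h p}) ∩
        ⋂ i, {h : Lower d | ∑ j : Fin (d i), h ⟨i, j⟩ = 1} := by
      ext h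
      simp [simplices]
    rw [this]
    refine (isClosed_iInter fun p => isClosed_le (by fun_prop) (by fun_prop)).inter
      (isClosed_iInter fun i => isClosed_eq (by fun_prop) (by fun_prop))
  refine Metric.isCompact_of_isClosed_isBounded hc
    (isBounded_iff_forall_norm_le.2 ⟨‖(WithLp.toLp 2 fun _ => 1 : Lower d)‖, fun h hh => ?_⟩)
  have := norm_le_of_forall_abs_le (v := (WithLp.toLp 2 fun _ => 1 : Lower d)) (w := h) zero_le_one
    fun p => by
      rw [abs_of_nonneg (hh.1 p)]
      simpa using le_one_of_mem_simplices hh p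
  simpa using this

lemma eventually_add_smul_mem_simplices {h v : Lower d} (hh : h ∈ simplices d)
    (hpos : ∀ p, 0 < h p) (hv : v ∈ tangent d) :
    ∀ᶠ t in 𝓝 (0 : ℝ), h + t • v ∈ simplices d := by
  have : ∀ᶠ t in 𝓝 (0 : ℝ), ∀ p, 0 < h p + t * v p := by
    refine eventually_all.2 fun p => ?_
    have : ContinuousAt (fun t : ℝ => h p + t * v p) 0 := by fun_prop
    exact this.eventually (lt_mem_nhds (by simpa using hpos p))
  filter_upwards [this] with t ht
  exact ⟨fun p => by simpa using (ht p).le,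
    fun i => by simp [Finset.sum_add_distrib, ← Finset.mul_sum, hh.2 i, hv i]⟩

/-- The uniform distribution on every block. -/
noncomputable def uniformPt (d : Fin N → ℕ) : Lower d := WithLp.toLp 2 fun p => 1 / (d p.1 : ℝ)

lemma uniformPt_pos (p) : 0 < uniformPt d p := by
  obtain ⟨i, j⟩ := p
  have : 0 < d i := j.pos
  simp only [uniformPt]
  positivity

lemma uniformPt_mem (hd : ∀ i, 0 < d i) : uniformPt d ∈ simplices d := by
  refine ⟨fun p => (uniformPt_pos p).le, fun i => ?_⟩
  have := hd i
  simp only [uniformPt, Finset.sum_const, Finset.card_univ, Fintype.card_fin, nsmul_eq_mul]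
  field_simp

lemma dist_le_of_mem_simplices (d : Fin N → ℕ) :
    ∃ Δ : ℝ, 0 ≤ Δ ∧ ∀ h ∈ simplices d, ∀ h' ∈ simplices d, ‖h - h'‖ ≤ Δ := by
  obtain ⟨K, hK⟩ := isBounded_iff_forall_norm_le.1 (isCompact_simplices d).isBounded
  refine ⟨2 * |K|, by positivity, fun h hh h' hh' => (norm_sub_le _ _).trans ?_⟩
  linarith [hK h hh, hK h' hh', le_abs_self K]

/-! ### Derivatives of the lower-level objective -/

section Lower

variable {g : Lower d → Upper m → ℝ} {C : Set (Upper m)} {Lg Ωg τh ρh Λ τy ρy : ℝ}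
  {h h' : Lower d} {y : Upper m}

lemma hasFDerivAt_gradH (hd : DifferentiableAt ℝ (fun h' => g h' y) h) :
    HasFDerivAt (fun h' => g h' y) (innerSL ℝ (gradH g h y)) h :=
  hd.hasGradientAt.hasFDerivAt

namespace LowerAssumptions

lemma hasFDerivAt (hg : LowerAssumptions g C Lg Ωg τh ρh Λ τy ρy) (hh : h ∈ simplices d)
    (hy : y ∈ C) : HasFDerivAt (fun h' => g h' y) (innerSL ℝ (gradH g h y)) h :=
  hasFDerivAt_gradH (hg.differentiable h hh y hy).self_of_nhds

lemma inner_gradH_le (hg : LowerAssumptions g C Lg Ωg τh ρh Λ τy ρy) (hh : h ∈ simplices d)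
    (hh' : h' ∈ simplices d) (hy : y ∈ C) : ⟪gradH g h y, h' - h⟫ ≤ g h' y - g h y :=
  convexOn_hasFDerivAt_le (hg.convex y hy) hh hh' (hg.hasFDerivAt hh hy)

lemma inner_gradH_sub_nonneg (hg : LowerAssumptions g C Lg Ωg τh ρh Λ τy ρy)
    (hh : h ∈ simplices d) (hh' : h' ∈ simplices d) (hy : y ∈ C) :
    0 ≤ ⟪h - h', gradH g h y - gradH g h' y⟫ := by
  have h1 := hg.inner_gradH_le hh hh' hy
  have h2 := hg.inner_gradH_le hh' hh hy
  rw [real_inner_comm, inner_sub_left]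
  rw [← neg_sub h h', inner_neg_right] at h1
  linarith

lemma Lg_nonneg (hg : LowerAssumptions g C Lg Ωg τh ρh Λ τy ρy) (hh : h ∈ simplices d)
    (hy : y ∈ C) : 0 ≤ Lg := (norm_nonneg _).trans (hg.bounded_hess y hy h hh)

lemma Λ_nonneg (hg : LowerAssumptions g C Lg Ωg τh ρh Λ τy ρy) (hh : h ∈ simplices d)
    (hy : y ∈ C) : 0 ≤ Λ := (norm_nonneg _).trans (hg.bounded_cross y hy h hh)

/-- The combination of smoothness and convexity that drives the mirror-descent estimate. -/
lemma inner_gradH_sub_ge (hg : LowerAssumptions g C Lg Ωg τh ρh Λ τy ρy) {hs : Lower d}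
    (hh : h ∈ simplices d) (hh' : h' ∈ simplices d) (hhs : hs ∈ simplices d) (hy : y ∈ C) :
    -(Lg * ‖h' - h‖ ^ 2) ≤ ⟪h' - hs, gradH g h y - gradH g hs y⟫ := by
  have h1 := (abs_le.1 (abs_sub_sub_inner_le (convex_simplices d) (hg.Lg_nonneg hh hy)
    (fun x hx => hg.hasFDerivAt hx hy) (fun x hx z hz => by
      rw [← map_sub, innerSL_apply_norm]
      exact hg.lipschitz_grad y hy x hx z hz) hh hh')).2
  have h2 := hg.inner_gradH_le hh hhs hy
  have h3 := hg.inner_gradH_le hhs hh' hy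
  simp only [innerSL_apply_apply] at h1
  have h4 : ⟪h' - hs, gradH g h y - gradH g hs y⟫ =
      ⟪gradH g h y, h' - h⟫ - ⟪gradH g h y, hs - h⟫ - ⟪gradH g hs y, h' - hs⟫ := by
    rw [real_inner_comm]
    simp only [inner_sub_left, inner_sub_right]
    ring
  linarith

lemma hasFDerivAt_gradH_prod (hg : LowerAssumptions g C Lg Ωg τh ρh Λ τy ρy)
    (hh : h ∈ simplices d) (hy : y ∈ C) :
    HasFDerivAt (fun z : Lower d × Upper m => gradH g z.1 z.2)
      ((hessH g h y).coprod (crossHess g h y)) (h, y) := by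
  have h1 := ((hg.contDiff_grad h hh y hy).differentiableAt one_ne_zero).hasFDerivAt
  set D := fderiv ℝ (fun z : Lower d × Upper m => gradH g z.1 z.2) (h, y)
  have h2 : HasFDerivAt (fun h' => gradH g h' y) (D ∘L .inl ℝ _ _) h :=
    HasFDerivAt.comp (f := fun h' => (h', y)) h h1 (hasFDerivAt_prodMk_left h y)
  have h3 : HasFDerivAt (fun y' => gradH g h y') (D ∘L .inr ℝ _ _) y :=
    HasFDerivAt.comp (f := fun y' => (h, y')) y h1 (hasFDerivAt_prodMk_right h y)
  have h4 : (hessH g h y).coprod (crossHess g h y) = D := by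
    rw [hessH, crossHess, h2.fderiv, h3.fderiv, ContinuousLinearMap.coprod_comp_inl_inr]
  rwa [h4]

lemma hasFDerivAt_hessH (hg : LowerAssumptions g C Lg Ωg τh ρh Λ τy ρy)
    (hh : h ∈ simplices d) (hy : y ∈ C) :
    HasFDerivAt (fun h' => gradH g h' y) (hessH g h y) h := by
  have := HasFDerivAt.comp (f := fun h' => (h', y)) h (hg.hasFDerivAt_gradH_prod hh hy)
    (hasFDerivAt_prodMk_left h y)
  rw [ContinuousLinearMap.coprod_comp_inl] at this
  exact this

lemma inner_hessH_comm (hg : LowerAssumptions g C Lg Ωg τh ρh Λ τy ρy)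
    (hh : h ∈ simplices d) (hy : y ∈ C) (v w : Lower d) :
    ⟪v, hessH g h y w⟫ = ⟪w, hessH g h y v⟫ := by
  have h1 : ∀ᶠ h' in 𝓝 h, HasFDerivAt (fun h' => g h' y) (innerSL ℝ (gradH g h' y)) h' := by
    have hc : Tendsto (fun h' : Lower d => (h', y)) (𝓝 h) (𝓝 (h, y)) := by
      rw [nhds_prod_eq]
      exact tendsto_id.prodMk tendsto_const_pure |>.mono_right (by gcongr; exact pure_le_nhds y)
    filter_upwards [hc.eventually (hg.differentiable h hh y hy)] with h' hh'
    exact hasFDerivAt_gradH hh'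
  have h2 : HasFDerivAt (fun h' => innerSL ℝ (gradH g h' y))
      ((innerSL ℝ : Lower d →L[ℝ] Lower d →L[ℝ] ℝ) ∘L hessH g h y) h :=
    (innerSL ℝ : Lower d →L[ℝ] Lower d →L[ℝ] ℝ).hasFDerivAt.comp h (hg.hasFDerivAt_hessH hh hy)
  have this : ⟪hessH g h y v, w⟫ = ⟪hessH g h y w, v⟫ :=
    second_derivative_symmetric_of_eventually_of_real h1 h2 v w
  rw [real_inner_comm, ← this, real_inner_comm]

/-- At points of the relative interior, the Hessian is positive semidefinite on the tangent
space. -/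
lemma inner_hessH_nonneg (hg : LowerAssumptions g C Lg Ωg τh ρh Λ τy ρy)
    (hh : h ∈ simplices d) (hpos : ∀ p, 0 < h p) (hy : y ∈ C) {v : Lower d}
    (hv : v ∈ tangent d) : 0 ≤ ⟪v, hessH g h y v⟫ := by
  have h1 : HasDerivAt (fun t : ℝ => gradH g (h + t • v) y) (hessH g h y v) 0 := by
    have h2 : HasDerivAt (fun t : ℝ => h + t • v) v 0 := by
      simpa using ((hasDerivAt_id (0 : ℝ)).smul_const v).const_add h
    have h3 : HasFDerivAt (fun h' => gradH g h' y) (hessH g h y) (h + (0 : ℝ) • v) := by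
      simpa using hg.hasFDerivAt_hessH hh hy
    exact h3.comp_hasDerivAt (0 : ℝ) h2
  have h2 := (hasDerivAt_iff_tendsto_slope_zero.1 h1).mono_left (nhdsGT_le_nhdsNE (0 : ℝ))
  have h3 := (tendsto_const_nhds (x := v)).inner (𝕜 := ℝ) h2
  refine ge_of_tendsto h3 ?_
  filter_upwards [nhdsWithin_le_nhds (eventually_add_smul_mem_simplices hh hpos hv),
    self_mem_nhdsWithin] with t hmem ht0
  have ht0 : 0 < t := ht0
  have h5 := hg.inner_gradH_sub_nonneg hmem hh hy
  rw [add_sub_cancel_left, inner_smul_left] at h5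
  simp only [zero_add, zero_smul, add_zero, inner_smul_right]
  have h6 := nonneg_of_mul_nonneg_right h5 (by simpa using ht0)
  positivity

end LowerAssumptions

lemma hasFDerivAt_entropy (hpos : ∀ p, 0 < h p) :
    HasFDerivAt (entropy : Lower d → ℝ)
      (innerSL ℝ (WithLp.toLp 2 fun p => Real.log (h p) : Lower d)) h := by
  have h1 : ∀ p ∈ Finset.univ, HasFDerivAt (fun h : Lower d => h p * Real.log (h p) - h p)
      (Real.log (h p) • (EuclideanSpace.proj p : Lower d →L[ℝ] ℝ)) h := fun p _ => by
    have h2 : HasDerivAt (fun x : ℝ => x * Real.log x - x) (Real.log (h p)) (h p) := by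
      have h3 := (Real.hasDerivAt_mul_log (hpos p).ne').sub (hasDerivAt_id (h p))
      rw [add_sub_cancel_right] at h3
      exact h3
    exact h2.comp_hasFDerivAt (f := fun h : Lower d => h p) h
      (EuclideanSpace.proj p : Lower d →L[ℝ] ℝ).hasFDerivAt
  have h3 := HasFDerivAt.fun_sum h1
  have h4 : innerSL ℝ (WithLp.toLp 2 fun p => Real.log (h p) : Lower d) =
      ∑ p, Real.log (h p) • (EuclideanSpace.proj p : Lower d →L[ℝ] ℝ) := by
    ext v
    rw [innerSL_apply_apply, inner_eq_sum]
    simp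
  rw [h4]
  exact h3

lemma gradH_gReg {η : ℝ} (hpos : ∀ p, 0 < h p) (hd : DifferentiableAt ℝ (fun h' => g h' y) h)
    (p) : gradH (gReg g η) h y p = gradH g h y p + η * Real.log (h p) := by
  have h1 := (hasFDerivAt_gradH hd).add ((hasFDerivAt_entropy hpos).const_mul η)
  rw [← map_smul, ← map_add] at h1
  have h2 : HasGradientAt (fun h' => gReg g η h' y)
      (gradH g h y + η • (WithLp.toLp 2 fun p => Real.log (h p) : Lower d)) h := h1
  rw [gradH, h2.gradient]
  simp

end Lower

/-! ### The Gibbs map -/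

/-- The blockwise softmax `w ↦ exp w / ∑ exp w`. -/
noncomputable def gibbs (w : Lower d) : Lower d :=
  WithLp.toLp 2 fun p => Real.exp (w p) / ∑ j : Fin (d p.1), Real.exp (w ⟨p.1, j⟩)

lemma sum_exp_pos (w : Lower d) (p : (i : Fin N) × Fin (d i)) :
    0 < ∑ j : Fin (d p.1), Real.exp (w ⟨p.1, j⟩) :=
  Finset.sum_pos (fun _ _ => Real.exp_pos _) ⟨p.2, Finset.mem_univ _⟩

lemma gibbs_apply (w : Lower d) (p) :
    gibbs w p = Real.exp (w p) / ∑ j : Fin (d p.1), Real.exp (w ⟨p.1, j⟩) := rfl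

lemma gibbs_pos (w : Lower d) (p) : 0 < gibbs w p :=
  div_pos (Real.exp_pos _) (sum_exp_pos w p)

lemma gibbs_mem (hd : ∀ i, 0 < d i) (w : Lower d) : gibbs w ∈ simplices d := by
  refine ⟨fun p => (gibbs_pos w p).le, fun i => ?_⟩
  have this (j) : gibbs w ⟨i, j⟩ =
      Real.exp (w ⟨i, j⟩) / ∑ k : Fin (d i), Real.exp (w ⟨i, k⟩) := rfl
  simp_rw [this]
  rw [← Finset.sum_div]
  exact div_self (sum_exp_pos w ⟨i, ⟨0, hd i⟩⟩).ne'

lemma log_gibbs (w : Lower d) (p) :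
    Real.log (gibbs w p) = w p - Real.log (∑ j : Fin (d p.1), Real.exp (w ⟨p.1, j⟩)) := by
  rw [gibbs_apply, Real.log_div (Real.exp_pos _).ne' (sum_exp_pos w p).ne', Real.log_exp]

/-- A point of the relative interior whose logarithm is `w` up to blockwise constants is the
Gibbs point of `w`. -/
lemma eq_gibbs {h w : Lower d} (hh : h ∈ simplices d) (hpos : ∀ p, 0 < h p) {c : Fin N → ℝ}
    (hw : ∀ p, Real.log (h p) = w p + c p.1) : h = gibbs w := by
  have h1 : ∀ p, h p = Real.exp (w p) * Real.exp (c p.1) := fun p => by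
    rw [← Real.exp_add, ← hw, Real.exp_log (hpos p)]
  ext p
  have h2 : (∑ j : Fin (d p.1), Real.exp (w ⟨p.1, j⟩)) * Real.exp (c p.1) = 1 := by
    rw [Finset.sum_mul, ← hh.2 p.1]
    exact Finset.sum_congr rfl fun j _ => (h1 ⟨p.1, j⟩).symm
  have := (sum_exp_pos w p).ne'
  rw [gibbs_apply, h1, eq_div_iff this, mul_assoc, mul_comm (Real.exp (c p.1)), h2, mul_one]

lemma hasFDerivAt_gibbs (w : Lower d) : HasFDerivAt gibbs (blockB (gibbs w)) w := by
  rw [← hasFDerivWithinAt_univ, hasFDerivWithinAt_euclidean]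
  intro p
  rw [hasFDerivWithinAt_univ]
  have h1 : ∀ q, HasFDerivAt (fun w : Lower d => Real.exp (w q))
      (Real.exp (w q) • (EuclideanSpace.proj q : Lower d →L[ℝ] ℝ)) w := fun q =>
    (Real.hasDerivAt_exp (w q)).comp_hasFDerivAt (f := fun w : Lower d => w q) w
      (EuclideanSpace.proj q : Lower d →L[ℝ] ℝ).hasFDerivAt
  have h2 := HasFDerivAt.fun_sum (u := Finset.univ) fun (j : Fin (d p.1)) _ => h1 ⟨p.1, j⟩
  have hZ := (sum_exp_pos w p).ne'
  have h3 := (h1 p).mul ((hasDerivAt_inv hZ).comp_hasFDerivAt w h2)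
  have hcomp : ((fun z : ℝ => z⁻¹) ∘ fun w : Lower d => ∑ j : Fin (d p.1),
      Real.exp (w ⟨p.1, j⟩)) w = (∑ j : Fin (d p.1), Real.exp (w ⟨p.1, j⟩))⁻¹ := rfl
  rw [hcomp] at h3
  refine HasFDerivAt.congr_fderiv (f := fun x => gibbs x p) h3 ?_
  ext v
  have e : ∑ j : Fin (d p.1), gibbs w ⟨p.1, j⟩ * v ⟨p.1, j⟩ =
      (∑ j : Fin (d p.1), Real.exp (w ⟨p.1, j⟩) * v ⟨p.1, j⟩) /
        ∑ j : Fin (d p.1), Real.exp (w ⟨p.1, j⟩) := by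
    rw [Finset.sum_div]
    exact Finset.sum_congr rfl fun j _ => div_mul_eq_mul_div _ _ _
  simp only [ContinuousLinearMap.comp_apply, PiLp.proj_apply, blockB_apply, e]
  rw [gibbs_apply]
  set Z := ∑ j : Fin (d p.1), Real.exp (w ⟨p.1, j⟩)
  simp
  field_simp
  ring

/-! ### Stationary points of the regularized lower-level problem -/

/-- First-order optimality of a point of the relative interior: the gradient of `g^η(·, y)` is
constant on every block. -/
def IsStationary (g : Lower d → Upper m → ℝ) (η : ℝ) (y : Upper m) (h : Lower d) : Prop :=
  h ∈ simplices d ∧ (∀ p, 0 < h p) ∧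
    ∃ c : Fin N → ℝ, ∀ p, η * Real.log (h p) + gradH g h y p = c p.1

section Stationary

variable {g : Lower d → Upper m → ℝ} {C : Set (Upper m)} {Lg Ωg τh ρh Λ τy ρy η : ℝ}
  {h h' : Lower d} {y : Upper m}

lemma isStationary_of_eq_gibbs (hd : ∀ i, 0 < d i) (hη : 0 < η)
    (hh : h = gibbs (-η⁻¹ • gradH g h y)) : IsStationary g η y h := by
  refine ⟨hh ▸ gibbs_mem hd _, fun p => hh ▸ gibbs_pos _ p,
    fun i => -η * Real.log (∑ j : Fin (d i), Real.exp ((-η⁻¹ • gradH g h y) ⟨i, j⟩)), fun p => ?_⟩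
  conv_lhs => enter [1, 2, 1]; rw [hh]
  rw [log_gibbs]
  simp only [PiLp.smul_apply, smul_eq_mul]
  field_simp
  ring

lemma IsStationary.eq_gibbs (hη : 0 < η) (hh : IsStationary g η y h) :
    h = gibbs (-η⁻¹ • gradH g h y) := by
  obtain ⟨hmem, hpos, c, hc⟩ := hh
  refine BilevelPMD.eq_gibbs hmem hpos (c := fun i => η⁻¹ * c i) fun p => ?_
  rw [← hc p]
  simp only [PiLp.smul_apply, smul_eq_mul]
  field_simp
  ring

lemma IsStationary.inner_eq_zero (hh : IsStationary g η y h) {e : Lower d} (he : e ∈ tangent d) :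
    ⟪e, η • (WithLp.toLp 2 fun p => Real.log (h p) : Lower d) + gradH g h y⟫ = 0 := by
  obtain ⟨-, -, c, hc⟩ := hh
  exact inner_eq_zero_of_blockConst he (c := c) fun p => by simpa using hc p

/-- The entropy forces minimizers into the relative interior: at a vanishing entry its one-sided
derivative towards the uniform distribution is `-∞`. -/
lemma pos_of_isMinOn (hd : ∀ i, 0 < d i) (hη : 0 < η) (hh : h ∈ simplices d)
    (hmin : IsMinOn (fun h' => gReg g η h' y) (simplices d) h)
    (hg : DifferentiableAt ℝ (fun h' => g h' y) h) (p) : 0 < h p := by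
  by_contra hp
  have hp0 : h p = 0 := le_antisymm (not_lt.1 hp) (hh.1 p)
  set u := uniformPt d with hu
  have hum : u ∈ simplices d := uniformPt_mem hd
  set φ : ℝ → ℝ := fun x => x * Real.log x - x with hφ
  have hconv : ConvexOn ℝ (Set.Ici 0) φ := Real.convexOn_mul_log.sub (concaveOn_id (convex_Ici 0))
  -- the increment of `g` is at most linear in `t`
  have h1 : ∀ᶠ t in 𝓝[>] (0 : ℝ), g (h + t • (u - h)) y - g h y ≤
      t * (⟪gradH g h y, u - h⟫ + 1) := by
    have h2 : HasDerivAt (fun t : ℝ => g (h + t • (u - h)) y) ⟪gradH g h y, u - h⟫ 0 := by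
      have h2 : HasDerivAt (fun t : ℝ => h + t • (u - h)) (u - h) 0 := by
        simpa using ((hasDerivAt_id (0 : ℝ)).smul_const (u - h)).const_add h
      have h3 : HasFDerivAt (fun h' => g h' y) (innerSL ℝ (gradH g h y))
          (h + (0 : ℝ) • (u - h)) := by simpa using hasFDerivAt_gradH hg
      exact h3.comp_hasDerivAt (0 : ℝ) h2
    have h3 := (hasDerivAt_iff_tendsto_slope_zero.1 h2).mono_left (nhdsGT_le_nhdsNE (0 : ℝ))
    filter_upwards [h3.eventually (gt_mem_nhds (lt_add_one _)), self_mem_nhdsWithin] with t ht ht0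
    have ht0 : 0 < t := ht0
    simp only [zero_add, zero_smul, add_zero, smul_eq_mul] at ht
    rw [inv_mul_lt_iff₀ ht0] at ht
    exact ht.le
  -- the increment of the entropy contains the term `t * log t`
  have h2 : ∀ t ∈ Set.Ioo (0 : ℝ) 1, entropy (h + t • (u - h)) - entropy h ≤
      t * (∑ q, (φ (u q) - φ (h q)) + u p * Real.log t) := fun t ht => by
    have hq : ∀ q, φ ((h + t • (u - h)) q) ≤ φ (h q) + t * (φ (u q) - φ (h q)) := fun q => by
      have := hconv.2 (hh.1 q) (hum.1 q) (sub_nonneg.2 ht.2.le) ht.1.le (sub_add_cancel 1 t)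
      simp only [smul_eq_mul] at this
      have e : (h + t • (u - h)) q = (1 - t) * h q + t * u q := by simp; ring
      rw [e]
      linarith
    have hpq : φ ((h + t • (u - h)) p) =
        φ (h p) + t * (φ (u p) - φ (h p)) + t * (u p * Real.log t) := by
      have e : (h + t • (u - h)) p = t * u p := by simp [hp0]
      rw [e, hp0]
      have e' : Real.log (t * u p) = Real.log t + Real.log (u p) :=
        Real.log_mul ht.1.ne' (uniformPt_pos p).ne'
      simp only [hφ, e']
      simp
      ring
    have : ∑ q, φ ((h + t • (u - h)) q) ≤
        ∑ q, (φ (h q) + t * (φ (u q) - φ (h q)) + if q = p then t * (u p * Real.log t) else 0) := by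
      refine Finset.sum_le_sum fun q _ => ?_
      split_ifs with hqp
      · subst hqp; exact hpq.le
      · simpa using hq q
    simp only [Finset.sum_add_distrib, ← Finset.mul_sum, Finset.sum_ite_eq', Finset.mem_univ,
      if_true] at this
    have e1 : entropy (h + t • (u - h)) = ∑ q, φ ((h + t • (u - h)) q) := rfl
    have e2 : entropy h = ∑ q, φ (h q) := rfl
    rw [e1, e2]
    linarith
  have h3 : Tendsto (fun t => (⟪gradH g h y, u - h⟫ + 1) +
      η * (∑ q, (φ (u q) - φ (h q)) + u p * Real.log t)) (𝓝[>] 0) atBot := by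
    refine tendsto_atBot_add_const_left _ _ (Tendsto.const_mul_atBot hη
      (tendsto_atBot_add_const_left _ _ (Tendsto.const_mul_atBot (uniformPt_pos p) ?_)))
    exact Real.tendsto_log_nhdsGT_zero
  obtain ⟨t, ht1, ht2, ht3⟩ := (h1.and ((h3.eventually (eventually_lt_atBot 0)).and
    (Ioo_mem_nhdsGT one_pos))).exists
  have hmem : h + t • (u - h) ∈ simplices d :=
    (convex_simplices d).add_smul_sub_mem hh hum ⟨ht3.1.le, ht3.2.le⟩
  have h4 := hmin hmem
  simp only [Set.mem_ofPred_eq, gReg] at h4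
  have h5 := mul_le_mul_of_nonneg_left (h2 t ht3) hη.le
  have h6 := mul_neg_of_pos_of_neg ht3.1 ht2
  nlinarith

lemma isStationary_of_isMinOn (hd : ∀ i, 0 < d i) (hη : 0 < η) (hh : h ∈ simplices d)
    (hmin : IsMinOn (fun h' => gReg g η h' y) (simplices d) h)
    (hg : DifferentiableAt ℝ (fun h' => g h' y) h) : IsStationary g η y h := by
  have hpos := pos_of_isMinOn hd hη hh hmin hg
  refine ⟨hh, hpos, ?_⟩
  set G : Lower d := gradH g h y + η • (WithLp.toLp 2 fun p => Real.log (h p) : Lower d) with hG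
  have h1 : HasFDerivAt (fun h' => gReg g η h' y) (innerSL ℝ G) h := by
    have h1 := (hasFDerivAt_gradH hg).add ((hasFDerivAt_entropy hpos).const_mul η)
    rwa [← map_smul, ← map_add] at h1
  have h2 : ∀ v ∈ tangent d, ⟪G, v⟫ = 0 := fun v hv => by
    have h2 : HasDerivAt (fun t : ℝ => h + t • v) v 0 := by
      simpa using ((hasDerivAt_id (0 : ℝ)).smul_const v).const_add h
    have h3 : HasFDerivAt (fun h' => gReg g η h' y) (innerSL ℝ G) (h + (0 : ℝ) • v) := by
      simpa using h1
    have h4 : HasDerivAt (fun t : ℝ => gReg g η (h + t • v) y) ⟪G, v⟫ 0 := by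
      simpa using! h3.comp_hasDerivAt (0 : ℝ) h2
    refine IsLocalMin.hasDerivAt_eq_zero ?_ h4
    filter_upwards [eventually_add_smul_mem_simplices hh hpos hv] with t ht
    simpa using hmin ht
  refine ⟨fun i => G ⟨i, ⟨0, hd i⟩⟩, fun p => ?_⟩
  have h3 : EuclideanSpace.single p (1 : ℝ) -
      EuclideanSpace.single (⟨p.1, ⟨0, hd p.1⟩⟩ : (i : Fin N) × Fin (d i)) (1 : ℝ) ∈ tangent d := by
    intro i
    by_cases hi : i = p.1
    · subst hi
      obtain ⟨i, j⟩ := p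
      simp
    · obtain ⟨k, j⟩ := p
      simp [hi]
  have h4 := h2 _ h3
  rw [inner_sub_right, EuclideanSpace.inner_single_right, EuclideanSpace.inner_single_right] at h4
  simp only [one_mul, conj_trivial] at h4
  have h5 : η * Real.log (h p) + gradH g h y p = G p := by simp [hG, add_comm]
  rw [h5]
  linarith

/-- Convexity is not needed here, so this applies to parameters outside of `C`. -/
lemma lowerSol_spec (hd : ∀ i, 0 < d i) (hη : 0 < η)
    (hg : ∀ h ∈ simplices d, DifferentiableAt ℝ (fun h' => g h' y) h) :
    IsStationary g η y (lowerSol g η y) := by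
  have hcont : ContinuousOn (fun h' => gReg g η h' y) (simplices d) := by
    refine ContinuousOn.add (fun h hh => (hg h hh).continuousAt.continuousWithinAt)
      (Continuous.continuousOn ?_)
    have : Continuous (entropy : Lower d → ℝ) :=
      continuous_finsetSum _ fun p _ => (Real.continuous_mul_log.comp (by fun_prop)).sub
        (by fun_prop)
    fun_prop
  have hex : ∃ h, h ∈ simplices d ∧ IsMinOn (fun h' => gReg g η h' y) (simplices d) h :=
    (isCompact_simplices d).exists_isMinOn ⟨_, uniformPt_mem hd⟩ hcont
  have hs := Classical.epsilon_spec hex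
  exact isStationary_of_isMinOn hd hη hs.1 hs.2 (hg _ hs.1)

lemma LowerAssumptions.isStationary_unique (hg : LowerAssumptions g C Lg Ωg τh ρh Λ τy ρy)
    (hη : 0 < η) (hy : y ∈ C) (hh : IsStationary g η y h) (hh' : IsStationary g η y h') :
    h = h' := by
  have ht := sub_mem_tangent hh.1 hh'.1
  have h1 := hh.inner_eq_zero ht
  have h2 := hh'.inner_eq_zero ht
  have h3 := hg.inner_gradH_sub_nonneg hh.1 hh'.1 hy
  simp only [inner_add_right, inner_smul_right, inner_sub_right] at h1 h2 h3
  have h4 : ∑ p, (h p - h' p) * (Real.log (h p) - Real.log (h' p)) ≤ 0 := by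
    have e : ∑ p, (h p - h' p) * (Real.log (h p) - Real.log (h' p)) =
        ⟪h - h', (WithLp.toLp 2 fun p => Real.log (h p) : Lower d)⟫ -
        ⟪h - h', (WithLp.toLp 2 fun p => Real.log (h' p) : Lower d)⟫ := by
      simp [inner_eq_sum, mul_sub]
    rw [e]
    have : η * (⟪h - h', (WithLp.toLp 2 fun p => Real.log (h p) : Lower d)⟫ -
        ⟪h - h', (WithLp.toLp 2 fun p => Real.log (h' p) : Lower d)⟫) ≤ 0 := by linarith
    exact nonpos_of_mul_nonpos_right this hη
  by_contra hne
  obtain ⟨p, hp⟩ : ∃ p, h p ≠ h' p := by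
    by_contra hall
    push Not at hall
    exact hne (PiLp.ext hall)
  refine h4.not_gt (Finset.sum_pos' (fun q _ => ?_) ⟨p, Finset.mem_univ p, ?_⟩)
  · rcases le_total (h q) (h' q) with hq | hq
    · exact mul_nonneg_of_nonpos_of_nonpos (sub_nonpos.2 hq)
        (sub_nonpos.2 (Real.log_le_log (hh.2.1 q) hq))
    · exact mul_nonneg (sub_nonneg.2 hq) (sub_nonneg.2 (Real.log_le_log (hh'.2.1 q) hq))
  · rcases lt_or_gt_of_ne hp with hq | hq
    · exact mul_pos_of_neg_of_neg (sub_neg.2 hq) (sub_neg.2 (Real.log_lt_log (hh.2.1 p) hq))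
    · exact mul_pos (sub_pos.2 hq) (sub_pos.2 (Real.log_lt_log (hh'.2.1 p) hq))

end Stationary

/-! ### Points with bounded logarithmic ratios -/

/-- The points of the relative interior whose logarithmic ratios within each block are at most
`M`. Their entries are bounded away from zero, and the inner iteration preserves this set. -/
def core (d : Fin N → ℕ) (M : ℝ) : Set (Lower d) :=
  {h | h ∈ simplices d ∧ (∀ p, 0 < h p) ∧
    ∀ i, ∀ j j' : Fin (d i), Real.log (h ⟨i, j⟩) - Real.log (h ⟨i, j'⟩) ≤ M}

lemma exists_le_of_mem_core (d : Fin N → ℕ) (M : ℝ) :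
    ∃ ν : ℝ, 0 < ν ∧ ∀ h ∈ core d M, ∀ p, ν ≤ h p := by
  refine ⟨Real.exp (-M) / (Fintype.card ((i : Fin N) × Fin (d i)) + 1), by positivity,
    fun h hh p => ?_⟩
  obtain ⟨i, j⟩ := p
  have h1 : ∀ k : Fin (d i), h ⟨i, k⟩ ≤ Real.exp M * h ⟨i, j⟩ := fun k => by
    have := Real.exp_le_exp.2 (sub_le_iff_le_add.1 (hh.2.2 i k j))
    rwa [Real.exp_add, Real.exp_log (hh.2.1 _), Real.exp_log (hh.2.1 _)] at this
  have h2 : (1 : ℝ) ≤ d i * (Real.exp M * h ⟨i, j⟩) := by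
    rw [← hh.1.2 i]
    simpa using Finset.sum_le_card_nsmul Finset.univ _ _ fun k _ => h1 k
  have h3 : (d i : ℝ) ≤ Fintype.card ((i : Fin N) × Fin (d i)) + 1 := by
    have : d i ≤ Fintype.card ((i : Fin N) × Fin (d i)) := by
      rw [Fintype.card_sigma]
      simpa using Finset.single_le_sum (f := d) (fun _ _ => Nat.zero_le _) (Finset.mem_univ i)
    have : (d i : ℝ) ≤ Fintype.card ((i : Fin N) × Fin (d i)) := by exact_mod_cast this
    linarith
  have h4 : 0 < Real.exp M * h ⟨i, j⟩ := mul_pos (Real.exp_pos _) (hh.2.1 _)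
  have h5 := h2.trans (mul_le_mul_of_nonneg_right h3 h4.le)
  rw [div_le_iff₀ (by positivity), Real.exp_neg, inv_le_iff_one_le_mul₀ (Real.exp_pos _)]
  linarith

lemma core_mono {M M' : ℝ} (hM : M ≤ M') : core d M ⊆ core d M' :=
  fun _ hh => ⟨hh.1, hh.2.1, fun i j j' => (hh.2.2 i j j').trans hM⟩

lemma innerSimplices_subset_core (Ωg η : ℝ) :
    innerSimplices d Ωg η ⊆ core d (-Real.log (nuMin d Ωg η)) := by
  intro h hh
  have hν : ∀ p : (i : Fin N) × Fin (d i), 0 < nuMin d Ωg η := fun p => by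
    have h1 : d p.1 ≤ Finset.univ.sup d := Finset.le_sup (Finset.mem_univ _)
    have h2 : 0 < d p.1 := p.2.pos
    have h3 : (0 : ℝ) < (Finset.univ.sup d : ℕ) := by exact_mod_cast h2.trans_le h1
    exact div_pos (Real.exp_pos _) h3
  have hpos : ∀ p, 0 < h p := fun p => (hν p).trans_le (hh.1 p)
  have hmem : h ∈ simplices d := ⟨fun p => (hpos p).le, hh.2⟩
  refine ⟨hmem, hpos, fun i j j' => ?_⟩
  have h1 := Real.log_nonpos (hmem.1 ⟨i, j⟩) (le_one_of_mem_simplices hmem _)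
  have h2 := Real.log_le_log (hν ⟨i, j'⟩) (hh.1 ⟨i, j'⟩)
  linarith

lemma norm_sq_le_inner_diagInv {h : Lower d} (hh : h ∈ simplices d) (hpos : ∀ p, 0 < h p)
    (v : Lower d) : ‖v‖ ^ 2 ≤ ⟪v, diagInv h v⟫ := by
  rw [EuclideanSpace.real_norm_sq_eq, inner_eq_sum]
  refine Finset.sum_le_sum fun p _ => ?_
  rw [diagInv_apply, ← mul_div_assoc, le_div_iff₀ (hpos p), ← sq]
  exact mul_le_of_le_one_right (sq_nonneg _) (le_one_of_mem_simplices hh p)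

lemma norm_diagInv_sub_le {h h' : Lower d} {ν : ℝ} (hν : 0 < ν) (hh : ∀ p, ν ≤ h p)
    (hh' : ∀ p, ν ≤ h' p) : ‖diagInv h - diagInv h'‖ ≤ (ν ^ 2)⁻¹ * ‖h - h'‖ := by
  refine ContinuousLinearMap.opNorm_le_bound _ (by positivity) fun v => ?_
  refine norm_le_of_forall_abs_le (by positivity) fun p => ?_
  have h1 := hν.trans_le (hh p)
  have h2 := hν.trans_le (hh' p)
  have e : (diagInv h - diagInv h') v p = (h p * h' p)⁻¹ * -((h - h') p) * v p := by
    simp only [sub_apply, PiLp.sub_apply, diagInv_apply]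
    field_simp
    ring
  rw [e, abs_mul, abs_mul, abs_neg, abs_of_pos (by positivity)]
  have h3 : (h p * h' p)⁻¹ ≤ (ν ^ 2)⁻¹ := by
    rw [sq]
    gcongr
    exacts [hh p, hh' p]
  gcongr
  exact abs_apply_le_norm _ _

/-! ### Differentiability of the lower-level solution map -/

/-- A weak form of the implicit function theorem: a solution `s` of `Ψ (s y, y) = const` that is
continuous at `y` is differentiable there, and uniqueness or regularity of `Ψ` away from
`(s y, y)` plays no role. -/
lemma hasFDerivAt_of_implicit {E F : Type*} [NormedAddCommGroup E] [NormedSpace ℝ E]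
    [NormedAddCommGroup F] [NormedSpace ℝ F] {Ψ : E × F → E} {A : E ≃L[ℝ] E} {T R : F →L[ℝ] E}
    {s : F → E} {y : F} (hΨ : HasFDerivAt Ψ ((A : E →L[ℝ] E).coprod T) (s y, y))
    (hs : ContinuousAt s y) (hsol : ∀ᶠ y' in 𝓝 y, Ψ (s y', y') = Ψ (s y, y))
    (hR : ∀ v, A (R v) + T v = 0) : HasFDerivAt s R y := by
  have h1 : Tendsto (fun y' => (s y', y')) (𝓝 y) (𝓝 (s y, y)) := hs.prodMk continuousAt_id
  have h2 := hΨ.isLittleO.comp_tendsto h1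
  set K := ‖(A.symm : E →L[ℝ] E)‖ + 1 with hK
  have hKpos : 0 < K := by positivity
  refine HasFDerivAt.of_isLittleO (Asymptotics.isLittleO_iff.2 fun c hc => ?_)
  obtain ⟨δ, hδ, hδ1, hδ2⟩ : ∃ δ > 0, δ ≤ 1 / 2 ∧ 2 * δ * (‖R‖ + 1) ≤ c := by
    refine ⟨min (1 / 2) (c / (2 * (‖R‖ + 1))), by positivity, min_le_left _ _, ?_⟩
    have := min_le_right (1 / 2) (c / (2 * (‖R‖ + 1)))
    rw [le_div_iff₀ (by positivity)] at this
    linarith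
  filter_upwards [Asymptotics.isLittleO_iff.1 h2 (div_pos hδ hKpos), hsol] with y' hy' hsol'
  simp only [Function.comp_apply, hsol', sub_self, zero_sub, norm_neg, Prod.mk_sub_mk,
    ContinuousLinearMap.coprod_apply, ContinuousLinearEquiv.coe_coe] at hy'
  set e := s y' - s y - R (y' - y) with he
  have h3 : A (s y' - s y) + T (y' - y) = A e := by
    have := hR (y' - y)
    rw [he, map_sub A (s y' - s y), eq_neg_of_add_eq_zero_right this, ← sub_eq_add_neg]
  rw [h3] at hy'
  have h4 : ‖e‖ ≤ K * ‖A e‖ := by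
    have := (A.symm : E →L[ℝ] E).le_opNorm (A e)
    simp only [ContinuousLinearEquiv.coe_coe, ContinuousLinearEquiv.symm_apply_apply] at this
    exact this.trans (by gcongr; linarith)
  have h5 : ‖(s y' - s y, y' - y)‖ ≤ ‖e‖ + (‖R‖ + 1) * ‖y' - y‖ := by
    have e1 : s y' - s y = e + R (y' - y) := by rw [he]; abel
    have e2 := R.le_opNorm (y' - y)
    have e3 := norm_add_le e (R (y' - y))
    have e4 := norm_nonneg e
    have e5 := norm_nonneg (y' - y)
    have e6 : 0 ≤ ‖R‖ * ‖y' - y‖ := by positivity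
    rw [Prod.norm_mk, max_le_iff, e1]
    constructor <;> linarith
  have h6 : ‖e‖ ≤ δ * (‖e‖ + (‖R‖ + 1) * ‖y' - y‖) := by
    calc ‖e‖ ≤ K * (δ / K * ‖(s y' - s y, y' - y)‖) := h4.trans (by gcongr)
      _ = δ * ‖(s y' - s y, y' - y)‖ := by field_simp
      _ ≤ _ := by gcongr
  have h7 : δ * ‖e‖ ≤ 1 / 2 * ‖e‖ := by gcongr
  calc ‖e‖ ≤ 2 * δ * (‖R‖ + 1) * ‖y' - y‖ := by linarith
    _ ≤ c * ‖y' - y‖ := by gcongr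

/-- The linearized optimality condition at `h`, in weak form: `R` is the derivative of the
solution map, tested against tangent vectors. -/
def IsSensitivity (g : Lower d → Upper m → ℝ) (η : ℝ) (y : Upper m) (h : Lower d)
    (R : Upper m →L[ℝ] Lower d) : Prop :=
  (∀ v, R v ∈ tangent d) ∧ ∀ e ∈ tangent d, ∀ v,
    ⟪e, η • diagInv h (R v) + hessH g h y (R v) + crossHess g h y v⟫ = 0

section Solution

variable {g : Lower d → Upper m → ℝ} {C : Set (Upper m)} {Lg Ωg τh ρh Λ τy ρy η : ℝ}
  {h h' : Lower d} {y : Upper m}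

namespace LowerAssumptions

lemma isStationary_mem_core (hg : LowerAssumptions g C Lg Ωg τh ρh Λ τy ρy) (hη : 0 < η)
    (hy : y ∈ C) (hh : IsStationary g η y h) : h ∈ core d (2 * Ωg / η) := by
  refine ⟨hh.1, hh.2.1, fun i j j' => ?_⟩
  obtain ⟨c, hc⟩ := hh.2.2
  have h1 := hc ⟨i, j⟩
  have h2 := hc ⟨i, j'⟩
  have h3 := hg.bounded_grad y hy h hh.1
  have h4 := abs_le.1 ((abs_apply_le_norm (gradH g h y) ⟨i, j⟩).trans h3)
  have h5 := abs_le.1 ((abs_apply_le_norm (gradH g h y) ⟨i, j'⟩).trans h3)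
  rw [le_div_iff₀ hη]
  simp only at h1 h2
  linarith

lemma isStationary_lowerSol (hg : LowerAssumptions g C Lg Ωg τh ρh Λ τy ρy)
    (hd : ∀ i, 0 < d i) (hη : 0 < η) (hy : y ∈ C) : IsStationary g η y (lowerSol g η y) :=
  lowerSol_spec hd hη fun _ hh => (hg.hasFDerivAt hh hy).differentiableAt

lemma eventually_isStationary (hg : LowerAssumptions g C Lg Ωg τh ρh Λ τy ρy)
    (hd : ∀ i, 0 < d i) (hη : 0 < η) (hy : y ∈ C) :
    ∀ᶠ y' in 𝓝 y, IsStationary g η y' (lowerSol g η y') := by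
  have h1 : ∀ᶠ y' in 𝓝 y, ∀ h ∈ simplices d, DifferentiableAt ℝ (fun h' => g h' y') h := by
    refine (isCompact_simplices d).eventually_forall_of_forall_eventually fun h hh => ?_
    have h2 := hg.differentiable h hh y hy
    exact (continuous_swap.tendsto (y, h)).eventually h2
  exact h1.mono fun y' hy' => lowerSol_spec hd hη hy'

/-- The solution map is continuous at the points of `C`, because its cluster points are
stationary and stationary points are unique over `C`. -/
lemma continuousAt_lowerSol (hg : LowerAssumptions g C Lg Ωg τh ρh Λ τy ρy)
    (hd : ∀ i, 0 < d i) (hη : 0 < η) (hy : y ∈ C) : ContinuousAt (lowerSol g η) y := by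
  have hev := hg.eventually_isStationary hd hη hy
  refine (isCompact_simplices d).tendsto_nhds_of_unique_mapClusterPt
    (hev.mono fun y' hy' => hy'.1) fun x hx hcl => ?_
  refine hg.isStationary_unique hη hy (isStationary_of_eq_gibbs hd hη ?_)
    (hg.isStationary_lowerSol hd hη hy)
  obtain ⟨U, hU, hUx⟩ := mapClusterPt_iff_ultrafilter.1 hcl
  have h1 : Tendsto (fun y' => (lowerSol g η y', y')) U (𝓝 (x, y)) :=
    hUx.prodMk_nhds hU
  have h2 : ContinuousAt (fun z : Lower d × Upper m => gibbs (-η⁻¹ • gradH g z.1 z.2)) (x, y) :=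
    ContinuousAt.comp (g := gibbs) (f := fun z : Lower d × Upper m => -η⁻¹ • gradH g z.1 z.2)
      (hasFDerivAt_gibbs _).continuousAt
      ((hg.hasFDerivAt_gradH_prod hx hy).const_smul (-η⁻¹)).continuousAt
  refine tendsto_nhds_unique hUx ((h2.tendsto.comp h1).congr' ?_)
  filter_upwards [hU hev] with y' hy'
  exact (hy'.eq_gibbs hη).symm

/-- Linearizing `h = gibbs (-η⁻¹ ∇_h g (h, y))` leads to the operator `1 + η⁻¹ B ∇_h² g`, which is
injective because the Hessian is positive semidefinite on the tangent space. -/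
lemma exists_hasFDerivAt_lowerSol (hg : LowerAssumptions g C Lg Ωg τh ρh Λ τy ρy)
    (hd : ∀ i, 0 < d i) (hη : 0 < η) (hy : y ∈ C) :
    ∃ R, HasFDerivAt (lowerSol g η) R y ∧ IsSensitivity g η y (lowerSol g η y) R := by
  have hst := hg.isStationary_lowerSol hd hη hy
  set a := lowerSol g η y with ha
  set H := hessH g a y
  set X := crossHess g a y
  set B := blockB a
  have hB : ∀ v, B v ∈ tangent d := blockB_mem_tangent hst.1.2
  set A₀ : Lower d →L[ℝ] Lower d := .id ℝ _ + η⁻¹ • (B ∘L H) with hA₀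
  have hinj : Function.Injective A₀ := by
    refine (injective_iff_map_eq_zero _).2 fun v hv => ?_
    have h1 : v = -(η⁻¹ • B (H v)) := by
      have : v + η⁻¹ • B (H v) = 0 := hv
      exact eq_neg_of_add_eq_zero_left this
    have hvt : v ∈ tangent d := by
      rw [h1]
      exact Submodule.neg_mem _ (Submodule.smul_mem _ _ (hB _))
    have h2 := norm_sq_le_inner_diagInv hst.1 hst.2.1 v
    have h3 : ⟪v, diagInv a v⟫ = -(η⁻¹ * ⟪v, H v⟫) := by
      have e1 : diagInv a v = -(η⁻¹ • diagInv a (B (H v))) := by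
        rw [← map_smul, ← map_neg, ← h1]
      rw [e1, inner_neg_right, inner_smul_right, inner_diagInv_blockB hst.2.1 hvt]
    have h4 := hg.inner_hessH_nonneg hst.1 hst.2.1 hy hvt
    have h5 : 0 ≤ η⁻¹ * ⟪v, H v⟫ := by positivity
    have h6 : ‖v‖ ^ 2 = 0 := le_antisymm (by linarith) (sq_nonneg _)
    simpa using h6
  set A : Lower d ≃L[ℝ] Lower d :=
    (LinearEquiv.ofInjectiveEndo A₀.toLinearMap hinj).toContinuousLinearEquiv
  have hA : (A : Lower d →L[ℝ] Lower d) = A₀ := by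
    ext v : 1
    rfl
  set R : Upper m →L[ℝ] Lower d := -((A.symm : Lower d →L[ℝ] Lower d) ∘L (η⁻¹ • (B ∘L X))) with hR
  have hRA : ∀ v, A (R v) + (η⁻¹ • (B ∘L X)) v = 0 := fun v => by simp [hR]
  have hReq : ∀ v, R v = -(η⁻¹ • B (H (R v) + X v)) := fun v => by
    have h1 := hRA v
    have h2 : A (R v) = R v + η⁻¹ • B (H (R v)) := rfl
    rw [h2] at h1
    rw [map_add, smul_add]
    refine eq_neg_of_add_eq_zero_left ?_
    rw [← add_assoc]
    exact h1
  refine ⟨R, ?_, fun v => ?_, fun e he v => ?_⟩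
  · refine hasFDerivAt_of_implicit
      (Ψ := fun z : Lower d × Upper m => z.1 - gibbs (-η⁻¹ • gradH g z.1 z.2)) (A := A)
      (T := η⁻¹ • (B ∘L X)) ?_ (hg.continuousAt_lowerSol hd hη hy) ?_ hRA
    · rw [hA]
      have h1 := (hg.hasFDerivAt_gradH_prod hst.1 hy).const_smul (-η⁻¹)
      have h2 := hasFDerivAt_gibbs (-η⁻¹ • gradH g a y)
      rw [← hst.eq_gibbs hη] at h2
      have h3 := (hasFDerivAt_fst (𝕜 := ℝ) (p := (a, y))).sub (HasFDerivAt.comp (a, y)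
        (f := fun z : Lower d × Upper m => -η⁻¹ • gradH g z.1 z.2) h2 h1)
      refine HasFDerivAt.congr_fderiv h3 ?_
      refine ContinuousLinearMap.ext fun z => ?_
      simp [hA₀, B, H, X, sub_neg_eq_add, add_assoc]
    · filter_upwards [hg.eventually_isStationary hd hη hy] with y' hy'
      change lowerSol g η y' - gibbs (-η⁻¹ • gradH g (lowerSol g η y') y') =
        a - gibbs (-η⁻¹ • gradH g a y)
      rw [← hy'.eq_gibbs hη, ← hst.eq_gibbs hη, sub_self, sub_self]
  · rw [hReq]
    exact Submodule.neg_mem _ (Submodule.smul_mem _ _ (hB _))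
  · have h1 : ⟪e, diagInv a (R v)⟫ = -(η⁻¹ * ⟪e, H (R v) + X v⟫) := by
      conv_lhs => rw [hReq]
      rw [map_neg, map_smul, inner_neg_right, inner_smul_right,
        inner_diagInv_blockB hst.2.1 he]
    rw [add_assoc, inner_add_right, inner_smul_right, h1]
    field_simp
    ring

lemma isSensitivity_fderiv (hg : LowerAssumptions g C Lg Ωg τh ρh Λ τy ρy)
    (hd : ∀ i, 0 < d i) (hη : 0 < η) (hy : y ∈ C) :
    IsSensitivity g η y (lowerSol g η y) (fderiv ℝ (lowerSol g η) y) := by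
  obtain ⟨R, hR, hs⟩ := hg.exists_hasFDerivAt_lowerSol hd hη hy
  rwa [hR.fderiv]

lemma hasFDerivAt_lowerSol (hg : LowerAssumptions g C Lg Ωg τh ρh Λ τy ρy)
    (hd : ∀ i, 0 < d i) (hη : 0 < η) (hy : y ∈ C) :
    HasFDerivAt (lowerSol g η) (fderiv ℝ (lowerSol g η) y) y := by
  obtain ⟨R, hR, -⟩ := hg.exists_hasFDerivAt_lowerSol hd hη hy
  exact hR.differentiableAt.hasFDerivAt

/-! ### Lipschitz continuity of the solution map and of its derivative -/

/-- Testing the linearized optimality condition against `R v` itself. -/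
lemma norm_sensitivity_le (hg : LowerAssumptions g C Lg Ωg τh ρh Λ τy ρy) (hη : 0 < η)
    (hy : y ∈ C) (hh : IsStationary g η y h) {R : Upper m →L[ℝ] Lower d}
    (hR : IsSensitivity g η y h R) : ‖R‖ ≤ Λ / η := by
  have hΛ := hg.Λ_nonneg hh.1 hy
  refine ContinuousLinearMap.opNorm_le_bound _ (by positivity) fun v => ?_
  have h1 := hR.2 _ (hR.1 v) v
  rw [inner_add_right, inner_add_right, inner_smul_right] at h1
  have h2 := hg.inner_hessH_nonneg hh.1 hh.2.1 hy (hR.1 v)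
  have h3 := mul_le_mul_of_nonneg_left (norm_sq_le_inner_diagInv hh.1 hh.2.1 (R v)) hη.le
  have h4 : -⟪R v, crossHess g h y v⟫ ≤ ‖R v‖ * (Λ * ‖v‖) := by
    refine (neg_le_abs _).trans ((abs_real_inner_le_norm _ _).trans ?_)
    gcongr
    exact (crossHess g h y).le_of_opNorm_le (hg.bounded_cross y hy h hh.1) v
  have h5 : ‖R v‖ * (η * ‖R v‖) ≤ ‖R v‖ * (Λ * ‖v‖) := by linarith [sq ‖R v‖]
  rcases (norm_nonneg (R v)).eq_or_lt with h6 | h6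
  · rw [← h6]
    positivity
  · have := le_of_mul_le_mul_left h5 h6
    rw [div_mul_eq_mul_div, le_div_iff₀ hη]
    linarith

lemma norm_fderiv_lowerSol_le (hg : LowerAssumptions g C Lg Ωg τh ρh Λ τy ρy)
    (hd : ∀ i, 0 < d i) (hη : 0 < η) (hy : y ∈ C) : ‖fderiv ℝ (lowerSol g η) y‖ ≤ Λ / η :=
  hg.norm_sensitivity_le hη hy (hg.isStationary_lowerSol hd hη hy)
    (hg.isSensitivity_fderiv hd hη hy)

lemma norm_lowerSol_sub_le (hg : LowerAssumptions g C Lg Ωg τh ρh Λ τy ρy)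
    (hd : ∀ i, 0 < d i) (hη : 0 < η) (hC : Convex ℝ C) {y' : Upper m} (hy : y ∈ C)
    (hy' : y' ∈ C) : ‖lowerSol g η y - lowerSol g η y'‖ ≤ Λ / η * ‖y - y'‖ :=
  hC.norm_image_sub_le_of_norm_hasFDerivWithin_le
    (fun _ hx => (hg.hasFDerivAt_lowerSol hd hη hx).hasFDerivWithinAt)
    (fun _ hx => hg.norm_fderiv_lowerSol_le hd hη hx) hy' hy

lemma norm_hessH_sub_le (hg : LowerAssumptions g C Lg Ωg τh ρh Λ τy ρy) {y' : Upper m}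
    (hh : h ∈ simplices d) (hh' : h' ∈ simplices d) (hy : y ∈ C) (hy' : y' ∈ C) :
    ‖hessH g h y - hessH g h' y'‖ ≤ |ρh| * ‖h - h'‖ + |ρy| * ‖y - y'‖ := by
  rw [← sub_add_sub_cancel (hessH g h y) (hessH g h' y)]
  refine (norm_add_le _ _).trans (add_le_add ((hg.lipschitz_hess_h y hy h hh h' hh').trans ?_)
    ((hg.lipschitz_hess_y h' hh' y hy y' hy').trans ?_))
  · gcongr; exact le_abs_self _
  · gcongr; exact le_abs_self _

lemma norm_crossHess_sub_le (hg : LowerAssumptions g C Lg Ωg τh ρh Λ τy ρy) {y' : Upper m}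
    (hh : h ∈ simplices d) (hh' : h' ∈ simplices d) (hy : y ∈ C) (hy' : y' ∈ C) :
    ‖crossHess g h y - crossHess g h' y'‖ ≤ |τh| * ‖h - h'‖ + |τy| * ‖y - y'‖ := by
  rw [← sub_add_sub_cancel (crossHess g h y) (crossHess g h' y)]
  refine (norm_add_le _ _).trans (add_le_add ((hg.lipschitz_cross_h y hy h hh h' hh').trans ?_)
    ((hg.lipschitz_cross_y h' hh' y hy y' hy').trans ?_))
  · gcongr; exact le_abs_self _
  · gcongr; exact le_abs_self _

lemma exists_lipschitz_fderiv_lowerSol (hg : LowerAssumptions g C Lg Ωg τh ρh Λ τy ρy)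
    (hd : ∀ i, 0 < d i) (hη : 0 < η) (hC : Convex ℝ C) : ∃ K : ℝ, 0 ≤ K ∧ ∀ y ∈ C, ∀ y' ∈ C,
      ‖fderiv ℝ (lowerSol g η) y - fderiv ℝ (lowerSol g η) y'‖ ≤ K * ‖y - y'‖ := by
  obtain ⟨ν, hν, hcore⟩ := exists_le_of_mem_core d (2 * Ωg / η)
  set ℓ := |Λ| / η with hℓ
  have hℓ0 : 0 ≤ ℓ := by positivity
  set K := (η * ((ν ^ 2)⁻¹ * ℓ) + (|ρh| * ℓ + |ρy|)) * ℓ + (|τh| * ℓ + |τy|) with hK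
  refine ⟨K / η, by positivity, fun y hy y' hy' => ?_⟩
  refine ContinuousLinearMap.opNorm_le_bound _ (by positivity) fun v => ?_
  have hs := hg.isStationary_lowerSol hd hη hy
  have hs' := hg.isStationary_lowerSol hd hη hy'
  have hR := hg.isSensitivity_fderiv hd hη hy
  have hR' := hg.isSensitivity_fderiv hd hη hy'
  have hRb : ‖fderiv ℝ (lowerSol g η) y'‖ ≤ ℓ :=
    (hg.norm_fderiv_lowerSol_le hd hη hy').trans (by rw [hℓ]; gcongr; exact le_abs_self _)
  have hab : ‖lowerSol g η y - lowerSol g η y'‖ ≤ ℓ * ‖y - y'‖ :=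
    (hg.norm_lowerSol_sub_le hd hη hC hy hy').trans (by rw [hℓ]; gcongr; exact le_abs_self _)
  have hca := hcore _ (hg.isStationary_mem_core hη hy hs)
  have hcb := hcore _ (hg.isStationary_mem_core hη hy' hs')
  set a := lowerSol g η y
  set b := lowerSol g η y'
  set R := fderiv ℝ (lowerSol g η) y
  set R' := fderiv ℝ (lowerSol g η) y'
  set e := (R - R') v with he
  have het : e ∈ tangent d := Submodule.sub_mem _ (hR.1 v) (hR'.1 v)
  have h1 := hR.2 e het v
  have h2 := hR'.2 e het v
  have hH := hg.inner_hessH_nonneg hs.1 hs.2.1 hy het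
  have hD := mul_le_mul_of_nonneg_left (norm_sq_le_inner_diagInv hs.1 hs.2.1 e) hη.le
  -- the difference of the two linearized optimality conditions
  set w := η • (diagInv a - diagInv b) (R' v) + (hessH g a y - hessH g b y') (R' v) +
    (crossHess g a y - crossHess g b y') v with hw
  have h3 : η * ⟪e, diagInv a e⟫ + ⟪e, hessH g a y e⟫ + ⟪e, w⟫ = 0 := by
    have e1 : R v = e + R' v := by simp [he]
    rw [e1] at h1
    simp only [hw, map_add, sub_apply, inner_add_right, inner_smul_right, inner_sub_right,
      smul_sub, smul_add] at h1 h2 ⊢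
    linarith
  have hwb : ‖w‖ ≤ K * ‖y - y'‖ * ‖v‖ := by
    have b1 := norm_diagInv_sub_le hν hca hcb
    have b2 := hg.norm_hessH_sub_le hs.1 hs'.1 hy hy'
    have b3 := hg.norm_crossHess_sub_le hs.1 hs'.1 hy hy'
    have b4 : ‖R' v‖ ≤ ℓ * ‖v‖ := R'.le_of_opNorm_le hRb v
    calc ‖w‖ ≤ ‖η • (diagInv a - diagInv b) (R' v)‖ + ‖(hessH g a y - hessH g b y') (R' v)‖ +
          ‖(crossHess g a y - crossHess g b y') v‖ := norm_add₃_le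
      _ ≤ η * (((ν ^ 2)⁻¹ * (ℓ * ‖y - y'‖)) * (ℓ * ‖v‖)) +
          (|ρh| * (ℓ * ‖y - y'‖) + |ρy| * ‖y - y'‖) * (ℓ * ‖v‖) +
          (|τh| * (ℓ * ‖y - y'‖) + |τy| * ‖y - y'‖) * ‖v‖ := by
        rw [norm_smul, Real.norm_of_nonneg hη.le]
        gcongr
        · refine (ContinuousLinearMap.le_opNorm _ _).trans ?_
          gcongr
          exact b1.trans (by gcongr)
        · refine (ContinuousLinearMap.le_opNorm _ _).trans ?_
          gcongr
          exact b2.trans (by gcongr)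
        · refine (ContinuousLinearMap.le_opNorm _ _).trans ?_
          gcongr
          exact b3.trans (by gcongr)
      _ = K * ‖y - y'‖ * ‖v‖ := by rw [hK]; ring
  have h4 : -⟪e, w⟫ ≤ ‖e‖ * (K * ‖y - y'‖ * ‖v‖) :=
    (neg_le_abs _).trans ((abs_real_inner_le_norm _ _).trans (by gcongr))
  have h5 : ‖e‖ * (η * ‖e‖) ≤ ‖e‖ * (K * ‖y - y'‖ * ‖v‖) := by linarith [sq ‖e‖]
  rcases (norm_nonneg e).eq_or_lt with h6 | h6
  · rw [← h6]
    positivity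
  · have := le_of_mul_le_mul_left h5 h6
    rw [div_mul_eq_mul_div, div_mul_eq_mul_div, le_div_iff₀ hη]
    linarith

end LowerAssumptions

end Solution

/-! ### The Kullback-Leibler divergence -/

/-- The entrywise logarithm. -/
noncomputable def logVec (h : Lower d) : Lower d := WithLp.toLp 2 fun p => Real.log (h p)

@[simp] lemma logVec_apply (h : Lower d) (p) : logVec h p = Real.log (h p) := rfl

/-- The Kullback-Leibler divergence, without the terms that cancel on the product of simplices. -/
noncomputable def klDiv (a b : Lower d) : ℝ := ⟪a, logVec a - logVec b⟫

/-- Pinsker's inequality up to the constant; it follows entrywise from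
`log x - log y ≥ 2 * (1 - √y / √x)`. -/
lemma norm_sub_sq_le_klDiv {a b : Lower d} (ha : a ∈ simplices d) (hb : b ∈ simplices d)
    (hapos : ∀ p, 0 < a p) (hbpos : ∀ p, 0 < b p) : ‖a - b‖ ^ 2 ≤ 4 * klDiv a b := by
  have key : ∀ x y : ℝ, 0 < x → x ≤ 1 → 0 < y → y ≤ 1 →
      (x - y) ^ 2 ≤ 4 * (x * (Real.log x - Real.log y) - (x - y)) := by
    intro x y hx hx1 hy hy1
    obtain ⟨u, hu, rfl⟩ : ∃ u, 0 < u ∧ u ^ 2 = x := ⟨√x, Real.sqrt_pos.2 hx, Real.sq_sqrt hx.le⟩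
    obtain ⟨v, hv, rfl⟩ : ∃ v, 0 < v ∧ v ^ 2 = y := ⟨√y, Real.sqrt_pos.2 hy, Real.sq_sqrt hy.le⟩
    have hu1 : u ≤ 1 := by nlinarith
    have hv1 : v ≤ 1 := by nlinarith
    have h1 : 1 - v / u ≤ Real.log u - Real.log v := by
      have := Real.one_sub_inv_le_log_of_pos (div_pos hu hv)
      rwa [inv_div, Real.log_div hu.ne' hv.ne'] at this
    have h2 : u ^ 2 * (2 * (1 - v / u)) ≤ u ^ 2 * (Real.log (u ^ 2) - Real.log (v ^ 2)) := by
      rw [Real.log_pow, Real.log_pow]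
      push_cast
      gcongr
      linarith
    have h3 : u ^ 2 * (2 * (1 - v / u)) = 2 * u ^ 2 - 2 * u * v := by field_simp
    have h4 : (u ^ 2 - v ^ 2) ^ 2 ≤ 4 * (u - v) ^ 2 := by
      have : (u + v) ^ 2 ≤ 2 ^ 2 := by gcongr; linarith
      calc (u ^ 2 - v ^ 2) ^ 2 = (u + v) ^ 2 * (u - v) ^ 2 := by ring
        _ ≤ 2 ^ 2 * (u - v) ^ 2 := by gcongr
        _ = 4 * (u - v) ^ 2 := by norm_num
    linarith [h2, h3, h4, sub_sq u v]
  have h0 : ∑ p, (a - b) p = 0 := by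
    rw [Fintype.sum_sigma]
    exact Finset.sum_eq_zero fun i _ => sub_mem_tangent ha hb i
  have h1 : klDiv a b = ∑ p, (a p * (Real.log (a p) - Real.log (b p)) - (a - b) p) := by
    rw [Finset.sum_sub_distrib, h0, sub_zero, klDiv, inner_eq_sum]
    rfl
  rw [h1, EuclideanSpace.real_norm_sq_eq, Finset.mul_sum]
  exact Finset.sum_le_sum fun p _ => key _ _ (hapos p) (le_one_of_mem_simplices ha p) (hbpos p)
    (le_one_of_mem_simplices hb p)

lemma klDiv_le {a b : Lower d} {ν : ℝ} (hν : 0 < ν) (ha : a ∈ simplices d) (hb : b ∈ simplices d)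
    (hapos : ∀ p, 0 < a p) (hbν : ∀ p, ν ≤ b p) : klDiv a b ≤ ν⁻¹ * ‖a - b‖ ^ 2 := by
  have h0 : ∑ p, (a - b) p = 0 := by
    rw [Fintype.sum_sigma]
    exact Finset.sum_eq_zero fun i _ => sub_mem_tangent ha hb i
  have h1 : ν⁻¹ * ‖a - b‖ ^ 2 = ∑ p, (ν⁻¹ * (a - b) p ^ 2 + (a - b) p) := by
    rw [Finset.sum_add_distrib, h0, add_zero, EuclideanSpace.real_norm_sq_eq, Finset.mul_sum]
  rw [h1, klDiv, inner_eq_sum]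
  refine Finset.sum_le_sum fun p _ => ?_
  have hb0 := hν.trans_le (hbν p)
  have h2 : Real.log (a p) - Real.log (b p) ≤ a p / b p - 1 := by
    rw [← Real.log_div (hapos p).ne' hb0.ne']
    exact Real.log_le_sub_one_of_pos (div_pos (hapos p) hb0)
  simp only [PiLp.sub_apply, logVec_apply]
  calc a p * (Real.log (a p) - Real.log (b p)) ≤ a p * (a p / b p - 1) :=
        mul_le_mul_of_nonneg_left h2 (hapos p).le
    _ = (b p)⁻¹ * (a p - b p) ^ 2 + (a p - b p) := by field_simp; ring
    _ ≤ ν⁻¹ * (a p - b p) ^ 2 + (a p - b p) := by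
        gcongr
        exact hbν p

/-! ### Linear convergence of the mirror-descent iteration -/

section MirrorDescent

variable {g : Lower d → Upper m → ℝ} {C : Set (Upper m)} {Lg Ωg τh ρh Λ τy ρy η α M : ℝ}
  {h hs : Lower d} {y : Upper m}

lemma pmdStep_eq_gibbs (hpos : ∀ p, 0 < h p) (hd : DifferentiableAt ℝ (fun h' => g h' y) h) :
    pmdStep g η α y h = gibbs ((1 - η * α) • logVec h - α • gradH g h y) := by
  have h1 : ∀ p, h p * Real.exp (-α * gradH (gReg g η) h y p) =
      Real.exp (((1 - η * α) • logVec h - α • gradH g h y) p) := fun p => by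
    conv_lhs => enter [1]; rw [← Real.exp_log (hpos p)]
    rw [← Real.exp_add, gradH_gReg hpos hd]
    congr 1
    simp
    ring
  ext p
  simp only [pmdStep, gibbs, h1]

namespace LowerAssumptions

lemma pmdStep_mem_core (hg : LowerAssumptions g C Lg Ωg τh ρh Λ τy ρy) (hd : ∀ i, 0 < d i)
    (hη : 0 < η) (hM : 2 * Ωg / η ≤ M) (hα : 0 ≤ α) (hηα : η * α ≤ 1) (hy : y ∈ C)
    (hh : h ∈ core d M) : pmdStep g η α y h ∈ core d M := by
  rw [pmdStep_eq_gibbs hh.2.1 (hg.hasFDerivAt hh.1 hy).differentiableAt]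
  refine ⟨gibbs_mem hd _, gibbs_pos _, fun i j j' => ?_⟩
  have h3 := hg.bounded_grad y hy h hh.1
  have h4 := abs_le.1 ((abs_apply_le_norm (gradH g h y) ⟨i, j⟩).trans h3)
  have h5 := abs_le.1 ((abs_apply_le_norm (gradH g h y) ⟨i, j'⟩).trans h3)
  have h6 := mul_le_mul_of_nonneg_left (hh.2.2 i j j') (sub_nonneg.2 hηα)
  have h7 : gradH g h y ⟨i, j'⟩ - gradH g h y ⟨i, j⟩ ≤ η * M := by
    rw [div_le_iff₀ hη] at hM
    linarith
  have h8 := mul_le_mul_of_nonneg_left h7 hα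
  rw [log_gibbs, log_gibbs]
  simp only [PiLp.sub_apply, PiLp.smul_apply, smul_eq_mul, logVec_apply]
  linarith

lemma klDiv_pmdStep_le (hg : LowerAssumptions g C Lg Ωg τh ρh Λ τy ρy) (hd : ∀ i, 0 < d i)
    (hη : 0 < η) (hα : 0 ≤ α) (hαL : α * (η + 4 * Lg) ≤ 1) (hy : y ∈ C) (hh : h ∈ core d M)
    (hst : IsStationary g η y hs) :
    klDiv hs (pmdStep g η α y h) ≤ (1 - η * α) * klDiv hs h := by
  have hL := hg.Lg_nonneg hh.1 hy
  have e0 := pmdStep_eq_gibbs (η := η) (α := α) hh.2.1 (hg.hasFDerivAt hh.1 hy).differentiableAt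
  set h' := pmdStep g η α y h
  have hm' : h' ∈ simplices d := e0 ▸ gibbs_mem hd _
  have hp' : ∀ p, 0 < h' p := fun p => e0 ▸ gibbs_pos _ p
  have ht := sub_mem_tangent hm' hst.1
  have h1 : ⟪h' - hs, logVec h' - ((1 - η * α) • logVec h - α • gradH g h y)⟫ = 0 := by
    refine inner_eq_zero_of_blockConst ht (c := fun i => -Real.log (∑ j : Fin (d i),
      Real.exp (((1 - η * α) • logVec h - α • gradH g h y) ⟨i, j⟩))) fun p => ?_
    rw [PiLp.sub_apply, logVec_apply, e0, log_gibbs]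
    ring
  have h2 : ⟪h' - hs, η • logVec hs + gradH g hs y⟫ = 0 := hst.inner_eq_zero ht
  have h3 := hg.inner_gradH_sub_ge hh.1 hm' hst.1 hy
  have h4 := norm_sub_sq_le_klDiv hm' hst.1 hp' hst.2.1
  have h5 := norm_sub_sq_le_klDiv hm' hh.1 hp' hh.2.1
  -- the three-point identity
  have h6 : klDiv hs h' = (1 - η * α) * klDiv hs h - η * α * klDiv h' hs
      - (1 - η * α) * klDiv h' h - α * ⟪h' - hs, gradH g h y - gradH g hs y⟫ := by
    simp only [klDiv, inner_sub_left, inner_sub_right, inner_add_right, inner_smul_right]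
      at h1 h2 ⊢
    linear_combination h1 - α * h2
  have hk1 : 0 ≤ klDiv h' hs := by linarith [sq_nonneg ‖h' - hs‖]
  have hk2 : 0 ≤ klDiv h' h := by linarith [sq_nonneg ‖h' - h‖]
  have h7 : 0 ≤ η * α * klDiv h' hs := by positivity
  have h8 := mul_le_mul_of_nonneg_left h3 hα
  have h9 := mul_le_mul_of_nonneg_left h5 (mul_nonneg hα hL)
  have h10 := mul_nonneg (sub_nonneg.2 hαL) hk2
  linarith

lemma lowerIter_mem_core (hg : LowerAssumptions g C Lg Ωg τh ρh Λ τy ρy) (hd : ∀ i, 0 < d i)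
    (hη : 0 < η) (hM : 2 * Ωg / η ≤ M) (hα : 0 ≤ α) (hηα : η * α ≤ 1) (hy : y ∈ C)
    (hh : h ∈ core d M) (t : ℕ) : (lowerIter g η α y h t).1 ∈ core d M := by
  induction t with
  | zero => exact hh
  | succ t ih => exact hg.pmdStep_mem_core hd hη hM hα hηα hy ih

/-- The diameter of the simplices bounds the initial divergence, so the constant depends neither on
the starting point nor on the parameter. -/
lemma exists_norm_lowerIter_sub_le (hg : LowerAssumptions g C Lg Ωg τh ρh Λ τy ρy)
    (hd : ∀ i, 0 < d i) (hη : 0 < η) (hM : 2 * Ωg / η ≤ M) : ∃ K : ℝ, 0 ≤ K ∧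
      ∀ α, 0 ≤ α → α * (η + 4 * |Lg|) ≤ 1 → ∀ y ∈ C, ∀ h ∈ core d M, ∀ t,
        ‖(lowerIter g η α y h t).1 - lowerSol g η y‖ ≤ K * √(1 - η * α) ^ t := by
  obtain ⟨ν, hν, hcore⟩ := exists_le_of_mem_core d M
  obtain ⟨Δ, hΔ, hdiam⟩ := dist_le_of_mem_simplices d
  refine ⟨√(4 * (ν⁻¹ * Δ ^ 2)), by positivity, fun α hα hαL y hy h hh t => ?_⟩
  have hs := hg.isStationary_lowerSol hd hη hy
  have hL := hg.Lg_nonneg hh.1 hy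
  rw [abs_of_nonneg hL] at hαL
  have hηα : η * α ≤ 1 := by nlinarith
  have hr : 0 ≤ 1 - η * α := sub_nonneg.2 hηα
  have hmem := hg.lowerIter_mem_core hd hη hM hα hηα hy hh
  have h1 : ∀ t, klDiv (lowerSol g η y) (lowerIter g η α y h t).1 ≤
      (1 - η * α) ^ t * (ν⁻¹ * Δ ^ 2) := fun t => by
    induction t with
    | zero =>
      rw [pow_zero, one_mul]
      refine (klDiv_le hν hs.1 hh.1 hs.2.1 (hcore h hh)).trans ?_
      gcongr
      exact hdiam _ hs.1 _ hh.1
    | succ t ih =>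
      refine (hg.klDiv_pmdStep_le hd hη hα hαL hy (hmem t) hs).trans ?_
      rw [pow_succ', mul_assoc]
      gcongr
  have h2 := norm_sub_sq_le_klDiv hs.1 (hmem t).1 hs.2.1 (hmem t).2.1
  rw [norm_sub_rev] at h2
  refine le_of_sq_le_sq (h2.trans ?_) (by positivity)
  rw [mul_pow, Real.sq_sqrt (by positivity), ← pow_mul, mul_comm t, pow_mul, Real.sq_sqrt hr]
  linarith [h1 t]

end LowerAssumptions

end MirrorDescent

/-! ### A perturbed linear recursion -/

/-- A linear recursion with rate `r ≤ s` and a perturbation that decays faster than `s ^ t`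
still decays like `s ^ t`: the factors `1 + (C / s) (q / s) ^ t` have a bounded product. -/
lemma exists_le_pow_of_perturbed_recursion {r q s C A : ℝ} (hr : r ≤ s) (hq : 0 ≤ q)
    (hqs : q < s) (hs1 : s ≤ 1) (hC : 0 ≤ C) (hA : 0 ≤ A) : ∃ K : ℝ, 0 ≤ K ∧
      ∀ a : ℕ → ℝ, (∀ t, 0 ≤ a t) → a 0 ≤ A →
        (∀ t, a (t + 1) ≤ r * a t + C * q ^ t * (a t + 1)) → ∀ t, a t ≤ K * s ^ t := by
  have hs : 0 < s := hq.trans_lt hqs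
  set ρ := q / s with hρ
  have hρ0 : 0 ≤ ρ := by positivity
  have hρ1 : ρ < 1 := (div_lt_one hs).2 hqs
  refine ⟨Real.exp (C / s * (1 - ρ)⁻¹) * (A + 1), by positivity, fun a ha ha0 hrec t => ?_⟩
  have h1 : ∀ t, a t + s ^ t ≤
      Real.exp (C / s * ∑ k ∈ Finset.range t, ρ ^ k) * (A + 1) * s ^ t := by
    intro t
    induction t with
    | zero => simpa using ha0
    | succ t ih =>
      have hq' : q ^ t = ρ ^ t * s ^ t := by rw [← mul_pow, hρ, div_mul_cancel₀ _ hs.ne']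
      have hst : s ^ t ≤ 1 := pow_le_one₀ hs.le hs1
      have e1 : C * q ^ t * (a t + 1) ≤ C * ρ ^ t * (a t + s ^ t) := by
        rw [hq']
        have : s ^ t * a t ≤ a t := mul_le_of_le_one_left (ha t) hst
        calc C * (ρ ^ t * s ^ t) * (a t + 1) = C * ρ ^ t * (s ^ t * a t + s ^ t) := by ring
          _ ≤ _ := by gcongr
      have e2 : r * a t ≤ s * a t := mul_le_mul_of_nonneg_right hr (ha t)
      have hap : 0 ≤ a t + s ^ t := add_nonneg (ha t) (by positivity)
      calc a (t + 1) + s ^ (t + 1) ≤ s * a t + C * ρ ^ t * (a t + s ^ t) + s ^ (t + 1) := by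
            linarith [hrec t]
        _ = s * ((C / s * ρ ^ t + 1) * (a t + s ^ t)) := by field_simp; ring
        _ ≤ s * (Real.exp (C / s * ρ ^ t) * (a t + s ^ t)) := by
            gcongr
            exact Real.add_one_le_exp _
        _ ≤ s * (Real.exp (C / s * ρ ^ t) *
              (Real.exp (C / s * ∑ k ∈ Finset.range t, ρ ^ k) * (A + 1) * s ^ t)) := by gcongr
        _ = _ := by
            rw [Finset.sum_range_succ, mul_add (C / s), Real.exp_add]
            ring
  have h2 : ∑ k ∈ Finset.range t, ρ ^ k ≤ (1 - ρ)⁻¹ := by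
    rw [← tsum_geometric_of_lt_one hρ0 hρ1]
    exact (summable_geometric_of_lt_one hρ0 hρ1).sum_le_tsum _ fun _ _ => by positivity
  calc a t ≤ a t + s ^ t := by linarith [pow_pos hs t]
    _ ≤ _ := h1 t
    _ ≤ _ := by gcongr

/-! ### Convergence of the Jacobian recursion -/

/-- The weight `diag (1 / √h)`, which turns `diag (1 / h)` into the Euclidean inner product. -/
noncomputable def sqrtWeight (h : Lower d) : Lower d →L[ℝ] Lower d :=
  diagInv (WithLp.toLp 2 fun p => √(h p))

lemma norm_sqrtWeight_sq {h : Lower d} (hpos : ∀ p, 0 < h p) (v : Lower d) :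
    ‖sqrtWeight h v‖ ^ 2 = ⟪v, diagInv h v⟫ := by
  rw [EuclideanSpace.real_norm_sq_eq, inner_eq_sum]
  refine Finset.sum_congr rfl fun p _ => ?_
  simp only [sqrtWeight, diagInv_apply, div_pow, Real.sq_sqrt (hpos p).le]
  ring

lemma norm_le_norm_sqrtWeight {h : Lower d} (hh : h ∈ simplices d) (hpos : ∀ p, 0 < h p)
    (v : Lower d) : ‖v‖ ≤ ‖sqrtWeight h v‖ := by
  refine le_of_sq_le_sq ?_ (norm_nonneg _)
  rw [norm_sqrtWeight_sq hpos]
  exact norm_sq_le_inner_diagInv hh hpos v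

lemma norm_diagInv_le {h : Lower d} {ν : ℝ} (hν : 0 < ν) (hh : ∀ p, ν ≤ h p) :
    ‖diagInv h‖ ≤ ν⁻¹ := by
  refine ContinuousLinearMap.opNorm_le_bound _ (by positivity) fun v => ?_
  refine norm_le_of_forall_abs_le (by positivity) fun p => ?_
  have := hν.trans_le (hh p)
  rw [diagInv_apply, abs_div, div_eq_inv_mul, abs_of_pos this]
  gcongr
  exact hh p

lemma norm_sqrtWeight_le {h : Lower d} {ν : ℝ} (hν : 0 < ν) (hmem : h ∈ simplices d)
    (hh : ∀ p, ν ≤ h p) : ‖sqrtWeight h‖ ≤ ν⁻¹ :=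
  norm_diagInv_le hν fun p => (hh p).trans <| Real.le_sqrt_of_sq_le <| by
    rw [sq]
    exact mul_le_of_le_one_left (hmem.1 p) (le_one_of_mem_simplices hmem p)

section Jacobian

variable {g : Lower d → Upper m → ℝ} {C : Set (Upper m)} {Lg Ωg τh ρh Λ τy ρy η α M ν : ℝ}
  {h h' hs : Lower d} {y : Upper m} {R R' Rs : Upper m →L[ℝ] Lower d}

lemma jacStep_apply (v : Upper m) : jacStep g η α y h h' R v =
    blockB h' ((1 - η * α) • diagInv h (R v) - α • hessH g h y (R v) - α • crossHess g h y v) := by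
  simp only [jacStep, add_apply, ContinuousLinearMap.comp_apply, sub_apply, smul_apply, map_sub,
    map_smul, neg_smul]
  abel

/-- The Jacobian step in weak form. -/
lemma inner_diagInv_jacStep (hpos : ∀ p, 0 < h' p) {e : Lower d} (he : e ∈ tangent d)
    (v : Upper m) : ⟪e, diagInv h' (jacStep g η α y h h' R v)⟫ =
      ⟪e, (1 - η * α) • diagInv h (R v) - α • hessH g h y (R v) - α • crossHess g h y v⟫ := by
  rw [jacStep_apply, inner_diagInv_blockB hpos he]

lemma jacStep_mem_tangent (hh' : h' ∈ simplices d) (v : Upper m) :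
    jacStep g η α y h h' R v ∈ tangent d := by
  rw [jacStep_apply]
  exact blockB_mem_tangent hh'.2 _

namespace LowerAssumptions

/-- The linear part of the error recursion contracts with factor `1 - η α` in the weighted norm:
the form `⟪x, ((1 - η α) diag (1 / h) - α ∇²g) z⟫` is symmetric and lies between `0` and
`(1 - η α) ⟪x, diag (1 / h) x⟫` on the diagonal. -/
lemma inner_contraction (hg : LowerAssumptions g C Lg Ωg τh ρh Λ τy ρy) (hα : 0 ≤ α)
    (hαL : α * Lg ≤ 1 - η * α) (hy : y ∈ C) (hh : h ∈ simplices d) (hpos : ∀ p, 0 < h p)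
    {x z : Lower d} (hx : x ∈ tangent d) (hz : z ∈ tangent d) :
    ⟪x, (1 - η * α) • diagInv h z - α • hessH g h y z⟫ ≤
      (1 - η * α) * ‖sqrtWeight h x‖ * ‖sqrtWeight h z‖ := by
  have hr : 0 ≤ 1 - η * α := (mul_nonneg hα (hg.Lg_nonneg hh hy)).trans hαL
  set Q : Lower d →L[ℝ] Lower d := (1 - η * α) • diagInv h - α • hessH g h y with hQ
  have hQe : ∀ u w : Lower d, ⟪u, Q w⟫ =
      (1 - η * α) * ⟪u, diagInv h w⟫ - α * ⟪u, hessH g h y w⟫ := fun u w => by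
    simp [hQ, inner_sub_right, inner_smul_right]
  have hsymm : ∀ u w, ⟪u, Q w⟫ = ⟪w, Q u⟫ := fun u w => by
    have e : ⟪u, diagInv h w⟫ = ⟪w, diagInv h u⟫ := by
      rw [inner_eq_sum, inner_eq_sum]
      refine Finset.sum_congr rfl fun p _ => ?_
      rw [diagInv_apply, diagInv_apply]
      ring
    rw [hQe, hQe, hg.inner_hessH_comm hh hy u w, e]
  have hle : ∀ u ∈ tangent d, ⟪u, Q u⟫ ≤ (1 - η * α) * ‖sqrtWeight h u‖ ^ 2 := fun u hu => by
    rw [hQe, norm_sqrtWeight_sq hpos]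
    linarith [mul_nonneg hα (hg.inner_hessH_nonneg hh hpos hy hu)]
  have hnn : ∀ u ∈ tangent d, 0 ≤ ⟪u, Q u⟫ := fun u hu => by
    have h1 : ⟪u, hessH g h y u⟫ ≤ Lg * ‖u‖ ^ 2 := by
      refine (real_inner_le_norm _ _).trans ?_
      have := (hessH g h y).le_of_opNorm_le (hg.bounded_hess y hy h hh) u
      calc ‖u‖ * ‖hessH g h y u‖ ≤ ‖u‖ * (Lg * ‖u‖) := by gcongr
        _ = _ := by ring
    have h2 := mul_le_mul_of_nonneg_left (norm_sq_le_inner_diagInv hh hpos u) hr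
    have h3 := mul_le_mul_of_nonneg_left h1 hα
    have h4 := mul_le_mul_of_nonneg_right hαL (sq_nonneg ‖u‖)
    rw [hQe]
    linarith
  refine abs_le_of_sq_le_sq' ?_ (by positivity) |>.2
  calc ⟪x, Q z⟫ ^ 2 ≤ ⟪x, Q x⟫ * ⟪z, Q z⟫ := inner_map_sq_le (tangent d) Q hsymm hnn hx hz
    _ ≤ ((1 - η * α) * ‖sqrtWeight h x‖ ^ 2) * ((1 - η * α) * ‖sqrtWeight h z‖ ^ 2) := by
        gcongr
        exacts [hnn z hz, hle x hx, hle z hz]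
    _ = _ := by ring

/-- A crude growth bound for the Jacobians; it only serves to control the perturbation in the error
recursion. -/
lemma norm_jacStep_le (hg : LowerAssumptions g C Lg Ωg τh ρh Λ τy ρy) (hα : 0 ≤ α)
    (hη : 0 < η) (hr : 0 ≤ 1 - η * α) (hy : y ∈ C) (hν : 0 < ν) (hh : h ∈ simplices d)
    (hhν : ∀ p, ν ≤ h p) (hh' : h' ∈ simplices d) (hpos' : ∀ p, 0 < h' p) :
    ‖jacStep g η α y h h' R‖ ≤ (ν⁻¹ + α * Lg + α * Λ) * (‖R‖ + 1) := by
  have hL := hg.Lg_nonneg hh hy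
  have hΛ := hg.Λ_nonneg hh hy
  refine ContinuousLinearMap.opNorm_le_bound _ (by positivity) fun v => ?_
  have ht : jacStep g η α y h h' R v ∈ tangent d := jacStep_mem_tangent hh' v
  have h1 := inner_diagInv_jacStep (g := g) (η := η) (α := α) (y := y) (h := h) (R := R)
    hpos' ht v
  set u := jacStep g η α y h h' R v
  set w := (1 - η * α) • diagInv h (R v) - α • hessH g h y (R v) - α • crossHess g h y v with hw
  have h2 : ‖w‖ ≤ (ν⁻¹ + α * Lg + α * Λ) * (‖R‖ + 1) * ‖v‖ := by
    have b1 : ‖diagInv h (R v)‖ ≤ ν⁻¹ * (‖R‖ * ‖v‖) :=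
      ((diagInv h).le_of_opNorm_le (norm_diagInv_le hν hhν) _).trans (by
        gcongr; exact R.le_opNorm v)
    have b2 : ‖hessH g h y (R v)‖ ≤ Lg * (‖R‖ * ‖v‖) :=
      ((hessH g h y).le_of_opNorm_le (hg.bounded_hess y hy h hh) _).trans (by
        gcongr; exact R.le_opNorm v)
    have b3 : ‖crossHess g h y v‖ ≤ Λ * ‖v‖ :=
      (crossHess g h y).le_of_opNorm_le (hg.bounded_cross y hy h hh) _
    have b4 : 1 - η * α ≤ 1 := by linarith [mul_nonneg hη.le hα]
    have b5 : 0 ≤ ν⁻¹ * ‖v‖ + α * Lg * ‖v‖ + α * Λ * ‖R‖ * ‖v‖ := by positivity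
    calc ‖w‖ ≤ ‖(1 - η * α) • diagInv h (R v)‖ + ‖α • hessH g h y (R v)‖ +
          ‖α • crossHess g h y v‖ := (norm_sub_le _ _).trans (by gcongr; exact norm_sub_le _ _)
      _ ≤ 1 * (ν⁻¹ * (‖R‖ * ‖v‖)) + α * (Lg * (‖R‖ * ‖v‖)) + α * (Λ * ‖v‖) := by
        rw [norm_smul, norm_smul, norm_smul, Real.norm_of_nonneg hr, Real.norm_of_nonneg hα]
        gcongr
      _ ≤ _ := by linarith
  have h3 := norm_sq_le_inner_diagInv hh' hpos' u
  have h4 : ‖u‖ * ‖u‖ ≤ ‖u‖ * ‖w‖ := by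
    rw [← sq]
    exact h3.trans (h1.le.trans (real_inner_le_norm _ _))
  rcases (norm_nonneg u).eq_or_lt with h6 | h6
  · rw [← h6]
    positivity
  · exact (le_of_mul_le_mul_left h4 h6).trans h2

/-- One step of the error recursion for the Jacobians, in the weighted norm. -/
lemma norm_sqrtWeight_jacStep_sub_le (hg : LowerAssumptions g C Lg Ωg τh ρh Λ τy ρy)
    (hη : 0 < η) (hα : 0 ≤ α) (hαL : α * Lg ≤ 1 - η * α) (hy : y ∈ C) (hν : 0 < ν)
    (hh : h ∈ simplices d) (hhν : ∀ p, ν ≤ h p) (hh' : h' ∈ simplices d) (hhν' : ∀ p, ν ≤ h' p)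
    (hsm : hs ∈ simplices d) (hsν : ∀ p, ν ≤ hs p) (hRt : ∀ v, R v ∈ tangent d)
    (hRs : IsSensitivity g η y hs Rs) (hR' : R' = jacStep g η α y h h' R) :
    ‖sqrtWeight hs ∘L (R' - Rs)‖ ≤ (1 - η * α) * ‖sqrtWeight hs ∘L (R - Rs)‖ +
      ((ν ^ 2)⁻¹ + α * |ρh| + α * |τh|) * (‖h - hs‖ + ‖h' - hs‖) * (‖R‖ + ‖R'‖ + 1) := by
  have hr : 0 ≤ 1 - η * α := (mul_nonneg hα (hg.Lg_nonneg hh hy)).trans hαL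
  have hspos : ∀ p, 0 < hs p := fun p => hν.trans_le (hsν p)
  have hpos' : ∀ p, 0 < h' p := fun p => hν.trans_le (hhν' p)
  refine ContinuousLinearMap.opNorm_le_bound _ (by positivity) fun v => ?_
  set e := (R - Rs) v with he
  set e' := (R' - Rs) v with he'
  have het : e ∈ tangent d := Submodule.sub_mem _ (hRt v) (hRs.1 v)
  have het' : e' ∈ tangent d :=
    Submodule.sub_mem _ (hR' ▸ jacStep_mem_tangent hh' v) (hRs.1 v)
  have h1 := inner_diagInv_jacStep (g := g) (η := η) (α := α) (y := y) (h := h) (R := R)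
    hpos' het' v
  rw [← hR'] at h1
  have h2 := hRs.2 e' het' v
  set w := (1 - η * α) • (diagInv h - diagInv hs) (R v) - α • (hessH g h y - hessH g hs y) (R v) -
    α • (crossHess g h y - crossHess g hs y) v + (diagInv hs - diagInv h') (R' v) with hw
  have h3 : ⟪e', diagInv hs e'⟫ =
      ⟪e', (1 - η * α) • diagInv hs e - α • hessH g hs y e⟫ + ⟪e', w⟫ := by
    have e1 : diagInv hs e' = diagInv hs (R' v) - diagInv hs (Rs v) := by simp [he']
    have e2 : diagInv hs e = diagInv hs (R v) - diagInv hs (Rs v) := by simp [he]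
    have e3 : hessH g hs y e = hessH g hs y (R v) - hessH g hs y (Rs v) := by simp [he]
    rw [e1, e2, e3]
    simp only [hw, sub_apply, inner_add_right, inner_smul_right, inner_sub_right,
      smul_sub] at h1 h2 ⊢
    linear_combination h1 - α * h2
  have h4 := hg.inner_contraction hα hαL hy hsm hspos het' het
  have hwb : ‖w‖ ≤ ((ν ^ 2)⁻¹ + α * |ρh| + α * |τh|) * (‖h - hs‖ + ‖h' - hs‖) *
      (‖R‖ + ‖R'‖ + 1) * ‖v‖ := by
    have b1 := norm_diagInv_sub_le hν hhν hsν
    have b2 : ‖hessH g h y - hessH g hs y‖ ≤ |ρh| * ‖h - hs‖ := by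
      simpa using hg.norm_hessH_sub_le hh hsm hy hy
    have b3 : ‖crossHess g h y - crossHess g hs y‖ ≤ |τh| * ‖h - hs‖ := by
      simpa using hg.norm_crossHess_sub_le hh hsm hy hy
    have b4 : ‖diagInv hs - diagInv h'‖ ≤ (ν ^ 2)⁻¹ * ‖h' - hs‖ := by
      rw [norm_sub_rev h']
      exact norm_diagInv_sub_le hν hsν hhν'
    have b5 : 1 - η * α ≤ 1 := by linarith [mul_nonneg hη.le hα]
    have b6 := R.le_opNorm v
    have b7 := R'.le_opNorm v
    set x := ‖h - hs‖
    set x' := ‖h' - hs‖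
    have hx : 0 ≤ x := norm_nonneg _
    have hx' : 0 ≤ x' := norm_nonneg _
    set k₁ := (ν ^ 2)⁻¹
    set k₂ := α * |ρh|
    set k₃ := α * |τh|
    have hk₁ : 0 ≤ k₁ := by positivity
    have hk₂ : 0 ≤ k₂ := by positivity
    have hk₃ : 0 ≤ k₃ := by positivity
    calc ‖w‖ ≤ ‖(1 - η * α) • (diagInv h - diagInv hs) (R v)‖ +
          ‖α • (hessH g h y - hessH g hs y) (R v)‖ +
          ‖α • (crossHess g h y - crossHess g hs y) v‖ + ‖(diagInv hs - diagInv h') (R' v)‖ := by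
          refine (norm_add_le _ _).trans ?_
          gcongr
          exact (norm_sub_le _ _).trans (by gcongr; exact norm_sub_le _ _)
      _ ≤ 1 * (k₁ * x * (‖R‖ * ‖v‖)) + α * (|ρh| * x * (‖R‖ * ‖v‖)) +
          α * (|τh| * x * ‖v‖) + k₁ * x' * (‖R'‖ * ‖v‖) := by
        rw [norm_smul, norm_smul, norm_smul, Real.norm_of_nonneg hr, Real.norm_of_nonneg hα]
        gcongr
        · exact (ContinuousLinearMap.le_opNorm _ _).trans (by gcongr)
        · exact (ContinuousLinearMap.le_opNorm _ _).trans (by gcongr)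
        · exact (ContinuousLinearMap.le_opNorm _ _).trans (by gcongr)
        · exact (ContinuousLinearMap.le_opNorm _ _).trans (by gcongr)
      _ = (k₁ * x * ‖R‖ + k₂ * x * ‖R‖ + k₃ * x * 1 + k₁ * x' * ‖R'‖) * ‖v‖ := by ring
      _ ≤ (k₁ * x * (‖R‖ + ‖R'‖ + 1) + k₂ * x * (‖R‖ + ‖R'‖ + 1) + k₃ * x * (‖R‖ + ‖R'‖ + 1) +
          k₁ * x' * (‖R‖ + ‖R'‖ + 1) + (k₂ + k₃) * x' * (‖R‖ + ‖R'‖ + 1)) * ‖v‖ := by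
        have a1 := norm_nonneg R
        have a2 := norm_nonneg R'
        have a3 : 0 ≤ (k₂ + k₃) * x' * (‖R‖ + ‖R'‖ + 1) := by positivity
        refine mul_le_mul_of_nonneg_right ?_ (norm_nonneg v)
        refine le_add_of_le_of_nonneg ?_ a3
        gcongr <;> linarith
      _ = _ := by ring
  have h5 : ‖sqrtWeight hs e'‖ * ‖sqrtWeight hs e'‖ ≤
      ‖sqrtWeight hs e'‖ * ((1 - η * α) * ‖sqrtWeight hs e‖ + ‖w‖) := by
    have b1 : ⟪e', w⟫ ≤ ‖sqrtWeight hs e'‖ * ‖w‖ := (real_inner_le_norm _ _).trans (by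
      gcongr
      exact norm_le_norm_sqrtWeight hsm hspos e')
    rw [← sq, norm_sqrtWeight_sq hspos, h3]
    linarith
  have h6 : ‖sqrtWeight hs e'‖ ≤ (1 - η * α) * ‖sqrtWeight hs e‖ + ‖w‖ := by
    rcases (norm_nonneg (sqrtWeight hs e')).eq_or_lt with h6 | h6
    · rw [← h6]
      positivity
    · exact le_of_mul_le_mul_left h5 h6
  have h7 : ‖sqrtWeight hs e‖ ≤ ‖sqrtWeight hs ∘L (R - Rs)‖ * ‖v‖ :=
    (sqrtWeight hs ∘L (R - Rs)).le_opNorm v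
  calc ‖(sqrtWeight hs ∘L (R' - Rs)) v‖ = ‖sqrtWeight hs e'‖ := rfl
    _ ≤ (1 - η * α) * (‖sqrtWeight hs ∘L (R - Rs)‖ * ‖v‖) + ‖w‖ := h6.trans (by gcongr)
    _ ≤ _ := by linarith

end LowerAssumptions

end Jacobian

/-! ### Uniform convergence of the inner loop -/

section Errors

variable {f g : Lower d → Upper m → ℝ} {C : Set (Upper m)}
  {Lf Ωf Lg Ωg τh ρh Λ τy ρy η α M : ℝ} {y y' : Upper m} {h h' : Lower d}

lemma lowerIter_mem_tangent (hmem : ∀ t, (lowerIter g η α y h t).1 ∈ simplices d) (t : ℕ)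
    (v : Upper m) : (lowerIter g η α y h t).2 v ∈ tangent d := by
  cases t with
  | zero => exact Submodule.zero_mem _
  | succ t => exact jacStep_mem_tangent (hmem (t + 1)) v

/-- Uniform linear convergence of the inner loop, for the iterates and for their Jacobians. -/
lemma LowerAssumptions.exists_lowerIter_error_le
    (hg : LowerAssumptions g C Lg Ωg τh ρh Λ τy ρy) (hd : ∀ i, 0 < d i) (hη : 0 < η)
    (hM : 2 * Ωg / η ≤ M) (hα : 0 < α) (hαL : α * (η + 4 * |Lg|) ≤ 1) :
    ∃ K : ℝ, 0 ≤ K ∧ ∀ y ∈ C, ∀ h ∈ core d M, ∀ t,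
      ‖(lowerIter g η α y h t).1 - lowerSol g η y‖ ≤ K * √(1 - η * α / 2) ^ t ∧
      ‖(lowerIter g η α y h t).2 - fderiv ℝ (lowerSol g η) y‖ ≤ K * √(1 - η * α / 2) ^ t := by
  obtain ⟨K₁, hK₁, hconv⟩ := hg.exists_norm_lowerIter_sub_le hd hη hM
  obtain ⟨ν, hν, hcore⟩ := exists_le_of_mem_core d M
  have hηα : 0 < η * α := mul_pos hη hα
  have hηα1 : η * α ≤ 1 := by
    have : 0 ≤ α * (4 * |Lg|) := by positivity
    linarith
  set q := √(1 - η * α) with hq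
  set s := √(1 - η * α / 2) with hs
  have hqs : q < s := Real.sqrt_lt_sqrt (by linarith) (by linarith)
  have hs1 : s ≤ 1 := Real.sqrt_le_one.2 (by linarith)
  have hq0 : 0 ≤ q := Real.sqrt_nonneg _
  have hrs : 1 - η * α ≤ s := by
    refine le_trans ?_ hqs.le
    exact Real.le_sqrt_of_sq_le (by nlinarith)
  set κ := (ν ^ 2)⁻¹ + α * |ρh| + α * |τh| with hκ
  set b := ν⁻¹ + α * |Lg| + α * |Λ| with hb
  set ℓ := |Λ| / η with hℓ
  have hκ0 : 0 ≤ κ := by positivity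
  have hb0 : 0 ≤ b := by positivity
  have hℓ0 : 0 ≤ ℓ := by positivity
  obtain ⟨K₂, hK₂, hrec⟩ := exists_le_pow_of_perturbed_recursion (r := 1 - η * α) (q := q) (s := s)
    (C := κ * (2 * K₁) * ((1 + b) * (ℓ + 1))) (A := ν⁻¹ * ℓ) hrs hq0 hqs hs1 (by positivity)
    (by positivity)
  refine ⟨K₁ + K₂, by positivity, fun y hy h hh t => ?_⟩
  have hst := hg.isStationary_lowerSol hd hη hy
  have hsν := hcore _ (core_mono hM (hg.isStationary_mem_core hη hy hst))
  have hmem := hg.lowerIter_mem_core hd hη hM hα.le hηα1 hy hh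
  have hR := hg.isSensitivity_fderiv hd hη hy
  have hL := hg.Lg_nonneg hh.1 hy
  have hΛ := hg.Λ_nonneg hh.1 hy
  have hRb : ‖fderiv ℝ (lowerSol g η) y‖ ≤ ℓ := by
    rw [hℓ, abs_of_nonneg hΛ]
    exact hg.norm_fderiv_lowerSol_le hd hη hy
  have hαL' : α * Lg ≤ 1 - η * α := by
    rw [abs_of_nonneg hL] at hαL
    linarith [mul_nonneg hα.le hL]
  have hh1 := hconv α hα.le hαL y hy h hh
  set Rs := fderiv ℝ (lowerSol g η) y
  set hs' := lowerSol g η y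
  have hs0 : 0 ≤ s := Real.sqrt_nonneg _
  constructor
  · calc ‖(lowerIter g η α y h t).1 - hs'‖ ≤ K₁ * q ^ t := hh1 t
      _ ≤ (K₁ + K₂) * s ^ t := by gcongr; linarith
  · have hle : ∀ T : Upper m →L[ℝ] Lower d, ‖T‖ ≤ ‖sqrtWeight hs' ∘L T‖ := fun T =>
      ContinuousLinearMap.opNorm_le_bound _ (norm_nonneg _) fun v =>
        (norm_le_norm_sqrtWeight hst.1 hst.2.1 _).trans
          ((sqrtWeight hs' ∘L T).le_opNorm v)
    have h2 := hrec (fun t => ‖sqrtWeight hs' ∘L ((lowerIter g η α y h t).2 - Rs)‖)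
      (fun _ => norm_nonneg _) ?_ ?_ t
    · calc _ ≤ _ := hle _
        _ ≤ K₂ * s ^ t := h2
        _ ≤ (K₁ + K₂) * s ^ t := by gcongr; linarith
    · refine (ContinuousLinearMap.opNorm_comp_le _ _).trans ?_
      have h0 : (lowerIter g η α y h 0).2 - Rs = -Rs := zero_sub _
      rw [h0, norm_neg]
      gcongr
      exact norm_sqrtWeight_le hν hst.1 hsν
    · intro t
      have e1 := hg.norm_sqrtWeight_jacStep_sub_le hη hα.le hαL' hy hν (hmem t).1
        (hcore _ (hmem t)) (hmem (t + 1)).1 (hcore _ (hmem (t + 1))) hst.1 hsν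
        (lowerIter_mem_tangent (fun t => (hmem t).1) t) hR (R' := (lowerIter g η α y h (t + 1)).2)
        rfl
      have e2 := hg.norm_jacStep_le (R := (lowerIter g η α y h t).2) hα.le hη (by linarith) hy hν
        (hmem t).1 (hcore _ (hmem t)) (hmem (t + 1)).1 (hmem (t + 1)).2.1
      have e2' : ‖(lowerIter g η α y h (t + 1)).2‖ ≤ b * (‖(lowerIter g η α y h t).2‖ + 1) := by
        rw [hb, abs_of_nonneg hL, abs_of_nonneg hΛ]
        exact e2
      have e3 := hh1 t
      have e4 : ‖(lowerIter g η α y h (t + 1)).1 - hs'‖ ≤ K₁ * q ^ t := (hh1 (t + 1)).trans (by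
        gcongr ?_ * ?_
        exact pow_le_pow_of_le_one hq0 (hqs.le.trans hs1) (Nat.le_succ t))
      set a := ‖sqrtWeight hs' ∘L ((lowerIter g η α y h t).2 - Rs)‖
      have e5 : ‖(lowerIter g η α y h t).2‖ ≤ a + ℓ := by
        have := norm_add_le ((lowerIter g η α y h t).2 - Rs) Rs
        rw [sub_add_cancel] at this
        linarith [hle ((lowerIter g η α y h t).2 - Rs)]
      have ha : 0 ≤ a := norm_nonneg _
      have e6 : ‖(lowerIter g η α y h t).2‖ + ‖(lowerIter g η α y h (t + 1)).2‖ + 1 ≤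
          (1 + b) * ((ℓ + 1) * (a + 1)) := by
        calc _ ≤ (1 + b) * (‖(lowerIter g η α y h t).2‖ + 1) := by linarith
          _ ≤ (1 + b) * (a + ℓ + 1) := by gcongr
          _ ≤ (1 + b) * ((ℓ + 1) * (a + 1)) := by
            gcongr
            linarith [mul_nonneg hℓ0 ha]
      refine e1.trans (add_le_add le_rfl ?_)
      calc _ ≤ κ * (K₁ * q ^ t + K₁ * q ^ t) * ((1 + b) * ((ℓ + 1) * (a + 1))) := by gcongr
        _ = _ := by ring

/-! ### The gradient of the bilevel objective -/

lemma norm_fst_le (z : WithLp 2 (Lower d × Upper m)) : ‖z.fst‖ ≤ ‖z‖ := by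
  refine le_of_sq_le_sq ?_ (norm_nonneg _)
  rw [WithLp.prod_norm_sq_eq_of_L2]
  linarith [sq_nonneg ‖z.snd‖]

lemma norm_snd_le (z : WithLp 2 (Lower d × Upper m)) : ‖z.snd‖ ≤ ‖z‖ := by
  refine le_of_sq_le_sq ?_ (norm_nonneg _)
  rw [WithLp.prod_norm_sq_eq_of_L2]
  linarith [sq_nonneg ‖z.fst‖]

lemma norm_le_norm_fst_add (z : WithLp 2 (Lower d × Upper m)) : ‖z‖ ≤ ‖z.fst‖ + ‖z.snd‖ := by
  refine le_of_sq_le_sq ?_ (by positivity)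
  rw [WithLp.prod_norm_sq_eq_of_L2]
  nlinarith [mul_nonneg (norm_nonneg z.fst) (norm_nonneg z.snd)]

/-- Continuity of the hypergradient formula in the point, the Jacobian and the parameter. -/
lemma UpperAssumptions.norm_hyperGrad_sub_le (hf : UpperAssumptions f C Lf Ωf)
    (hh : h ∈ simplices d) (hh' : h' ∈ simplices d) (hy : y ∈ C) (hy' : y' ∈ C)
    {R R' : Upper m →L[ℝ] Lower d} {ℓ : ℝ} (hR' : ‖R'‖ ≤ ℓ) :
    ‖hyperGrad f h R y - hyperGrad f h' R' y'‖ ≤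
      (1 + ℓ) * |Lf| * (‖h - h'‖ + ‖y - y'‖) + |Ωf| * ‖R - R'‖ := by
  set z := gradZ f h y with hz
  set z' := gradZ f h' y' with hz'
  have hzz : ‖z - z'‖ ≤ |Lf| * (‖h - h'‖ + ‖y - y'‖) := by
    refine (hf.lipschitz_grad h hh y hy h' hh' y' hy').trans ?_
    gcongr
    · exact le_abs_self _
    · exact norm_le_norm_fst_add _
  have e : hyperGrad f h R y - hyperGrad f h' R' y' = (z - z').snd +
      (ContinuousLinearMap.adjoint (R - R') z.fst +
        ContinuousLinearMap.adjoint R' (z - z').fst) := by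
    simp only [hyperGrad, ← hz, ← hz', map_sub, sub_apply, WithLp.sub_fst, WithLp.sub_snd]
    abel
  have b1 : ‖ContinuousLinearMap.adjoint (R - R') z.fst‖ ≤ ‖R - R'‖ * |Ωf| := by
    refine (ContinuousLinearMap.le_opNorm _ _).trans ?_
    rw [LinearIsometryEquiv.norm_map]
    gcongr
    exact (norm_fst_le z).trans ((hf.bounded_grad h hh y hy).trans (le_abs_self _))
  have b2 : ‖ContinuousLinearMap.adjoint R' (z - z').fst‖ ≤ ℓ * ‖z - z'‖ := by
    refine (ContinuousLinearMap.le_opNorm _ _).trans ?_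
    rw [LinearIsometryEquiv.norm_map]
    exact mul_le_mul hR' (norm_fst_le _) (norm_nonneg _) ((norm_nonneg _).trans hR')
  have hℓ : 0 ≤ ℓ := (norm_nonneg _).trans hR'
  rw [e]
  calc _ ≤ ‖(z - z').snd‖ + (‖ContinuousLinearMap.adjoint (R - R') z.fst‖ +
        ‖ContinuousLinearMap.adjoint R' (z - z').fst‖) :=
        (norm_add_le _ _).trans (by gcongr; exact norm_add_le _ _)
    _ ≤ ‖z - z'‖ + (‖R - R'‖ * |Ωf| + ℓ * ‖z - z'‖) := by
        gcongr
        exact norm_snd_le _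
    _ = (1 + ℓ) * ‖z - z'‖ + |Ωf| * ‖R - R'‖ := by ring
    _ ≤ (1 + ℓ) * (|Lf| * (‖h - h'‖ + ‖y - y'‖)) + |Ωf| * ‖R - R'‖ := by gcongr
    _ = _ := by ring

lemma hasGradientAt_objective (hf : UpperAssumptions f C Lf Ωf)
    (hg : LowerAssumptions g C Lg Ωg τh ρh Λ τy ρy) (hd : ∀ i, 0 < d i) (hη : 0 < η)
    (hy : y ∈ C) : HasGradientAt (objective f g η)
      (hyperGrad f (lowerSol g η y) (fderiv ℝ (lowerSol g η) y) y) y := by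
  have hst := hg.isStationary_lowerSol hd hη hy
  have h1 : HasFDerivAt (fun z : WithLp 2 (Lower d × Upper m) => f z.fst z.snd)
      (innerSL ℝ (gradZ f (lowerSol g η y) y)) (WithLp.toLp 2 (lowerSol g η y, y)) :=
    (hf.differentiable _ hst.1 y hy).hasGradientAt.hasFDerivAt
  have h2 : HasFDerivAt (fun y' : Upper m => WithLp.toLp 2 (lowerSol g η y', y'))
      ((WithLp.prodContinuousLinearEquiv 2 ℝ (Lower d) (Upper m)).symm.toContinuousLinearMap ∘L
        ((fderiv ℝ (lowerSol g η) y).prod (.id ℝ _))) y :=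
    (WithLp.prodContinuousLinearEquiv 2 ℝ (Lower d) (Upper m)).symm.hasFDerivAt.comp y
      ((hg.hasFDerivAt_lowerSol hd hη hy).prodMk (hasFDerivAt_id y))
  have h3 := HasFDerivAt.comp y
    (f := fun y' : Upper m => (WithLp.toLp 2 (lowerSol g η y', y') : WithLp 2 _)) h1 h2
  rw [hasGradientAt_iff_hasFDerivAt]
  refine HasFDerivAt.congr_fderiv (f := objective f g η) h3 ?_
  ext v
  simp [hyperGrad, WithLp.prod_inner_apply, add_comm,
    ContinuousLinearMap.adjoint_inner_left]

lemma exists_lipschitz_gradient_objective (hf : UpperAssumptions f C Lf Ωf)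
    (hg : LowerAssumptions g C Lg Ωg τh ρh Λ τy ρy) (hd : ∀ i, 0 < d i) (hη : 0 < η)
    (hC : Convex ℝ C) : ∃ L : ℝ, 0 ≤ L ∧ ∀ y ∈ C, ∀ y' ∈ C,
      ‖gradient (objective f g η) y - gradient (objective f g η) y'‖ ≤ L * ‖y - y'‖ := by
  obtain ⟨K, hK, hlip⟩ := hg.exists_lipschitz_fderiv_lowerSol hd hη hC
  set ℓ := |Λ| / η with hℓ
  have hℓ0 : 0 ≤ ℓ := by positivity
  refine ⟨(1 + ℓ) * |Lf| * (ℓ + 1) + |Ωf| * K, by positivity, fun y hy y' hy' => ?_⟩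
  rw [(hasGradientAt_objective hf hg hd hη hy).gradient,
    (hasGradientAt_objective hf hg hd hη hy').gradient]
  have h1 : Λ / η ≤ ℓ := by rw [hℓ]; gcongr; exact le_abs_self _
  refine (hf.norm_hyperGrad_sub_le (hg.isStationary_lowerSol hd hη hy).1
    (hg.isStationary_lowerSol hd hη hy').1 hy hy'
    ((hg.norm_fderiv_lowerSol_le hd hη hy').trans h1)).trans ?_
  have h2 : ‖lowerSol g η y - lowerSol g η y'‖ ≤ ℓ * ‖y - y'‖ :=
    (hg.norm_lowerSol_sub_le hd hη hC hy hy').trans (by gcongr)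
  calc _ ≤ (1 + ℓ) * |Lf| * (ℓ * ‖y - y'‖ + ‖y - y'‖) + |Ωf| * (K * ‖y - y'‖) := by
        gcongr
        exact hlip y hy y' hy'
    _ = _ := by ring

/-- The hypergradient estimator after `t` inner steps has an error of order `√(1 - η α / 2) ^ t`,
uniformly in the starting point. -/
lemma exists_hyperGrad_error_le (hf : UpperAssumptions f C Lf Ωf)
    (hg : LowerAssumptions g C Lg Ωg τh ρh Λ τy ρy) (hd : ∀ i, 0 < d i) (hη : 0 < η)
    (hM : 2 * Ωg / η ≤ M) (hα : 0 < α) (hαL : α * (η + 4 * |Lg|) ≤ 1) :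
    ∃ K : ℝ, 0 ≤ K ∧ ∀ y ∈ C, ∀ h ∈ core d M, ∀ t,
      ‖hyperGrad f (lowerIter g η α y h t).1 (lowerIter g η α y h t).2 y -
        gradient (objective f g η) y‖ ≤ K * √(1 - η * α / 2) ^ t := by
  obtain ⟨K, hK, herr⟩ := hg.exists_lowerIter_error_le hd hη hM hα hαL
  set ℓ := |Λ| / η with hℓ
  have hℓ0 : 0 ≤ ℓ := by positivity
  refine ⟨(1 + ℓ) * |Lf| * K + |Ωf| * K, by positivity, fun y hy h hh t => ?_⟩
  obtain ⟨h1, h2⟩ := herr y hy h hh t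
  have h3 : Λ / η ≤ ℓ := by rw [hℓ]; gcongr; exact le_abs_self _
  have hηα1 : η * α ≤ 1 := by
    have : 0 ≤ α * (4 * |Lg|) := by positivity
    linarith
  rw [(hasGradientAt_objective hf hg hd hη hy).gradient]
  refine (hf.norm_hyperGrad_sub_le (hg.lowerIter_mem_core hd hη hM hα.le hηα1 hy hh t).1
    (hg.isStationary_lowerSol hd hη hy).1 hy hy
    ((hg.norm_fderiv_lowerSol_le hd hη hy).trans h3)).trans ?_
  rw [sub_self, norm_zero, add_zero]
  calc _ ≤ (1 + ℓ) * |Lf| * (K * √(1 - η * α / 2) ^ t) + |Ωf| * (K * √(1 - η * α / 2) ^ t) := by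
        gcongr
    _ = _ := by ring

end Errors

/-! ### Inexact projected gradient descent -/

lemma proj_spec {C : Set (Upper m)} (hC : IsClosed C) (hconv : Convex ℝ C) (hne : C.Nonempty)
    (x : Upper m) : proj C x ∈ C ∧ ∀ w ∈ C, ⟪x - proj C x, w - proj C x⟫ ≤ 0 := by
  have hex : ∃ p, p ∈ C ∧ ∀ w ∈ C, dist x p ≤ dist x w := by
    obtain ⟨p, hp, hxp⟩ := hC.exists_infDist_eq_dist hne x
    exact ⟨p, hp, fun w hw => hxp ▸ Metric.infDist_le_dist_of_mem hw⟩
  obtain ⟨h1, h2⟩ : proj C x ∈ C ∧ ∀ w ∈ C, dist x (proj C x) ≤ dist x w :=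
    Classical.epsilon_spec hex
  refine ⟨h1, (norm_eq_iInf_iff_real_inner_le_zero hconv h1).1 ?_⟩
  have : Nonempty C := ⟨⟨_, h1⟩⟩
  refine le_antisymm (le_ciInf fun w => ?_)
    (ciInf_le ⟨0, by rintro _ ⟨w, rfl⟩; exact norm_nonneg _⟩ (⟨_, h1⟩ : C))
  simpa only [dist_eq_norm] using h2 w w.2

/-- One step of projected gradient descent along `v` with a gradient error of norm at most `ε` decreases
`F` enough to control the stationarity of the next iterate: the residual
`(y - y⁺) / β - v` of the projection lies in the normal cone at `y⁺`. -/
lemma infDist_normalCone_sq_le {C : Set (Upper m)} (hC : IsClosed C) (hconv : Convex ℝ C)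
    {F : Upper m → ℝ} {G : Upper m → Upper m} {L β ε : ℝ} (hL : 0 ≤ L) (hβ : 0 < β)
    (hβL : 4 * β * L ≤ 1) (hF : ∀ x ∈ C, HasGradientAt F (G x) x)
    (hlip : ∀ x ∈ C, ∀ x' ∈ C, ‖G x - G x'‖ ≤ L * ‖x - x'‖) {y v : Upper m} (hy : y ∈ C)
    (hv : ‖v - G y‖ ≤ ε) :
    Metric.infDist (-G (proj C (y - β • v))) (normalCone C (proj C (y - β • v))) ^ 2 ≤
      16 / β * (F y - F (proj C (y - β • v))) + 18 * ε ^ 2 := by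
  obtain ⟨hmem, hproj⟩ := proj_spec hC hconv ⟨y, hy⟩ (y - β • v)
  set y' := proj C (y - β • v)
  have hε : 0 ≤ ε := (norm_nonneg _).trans hv
  set δ := ‖y' - y‖ with hδ
  have hδ0 : 0 ≤ δ := norm_nonneg _
  have hLβ : L ≤ 1 / (4 * β) := by
    rw [le_div_iff₀ (by positivity)]
    linarith
  have hdesc : F y' ≤ F y + ⟪G y, y' - y⟫ + L * δ ^ 2 := by
    have := (abs_le.1 (abs_sub_sub_inner_le hconv hL
      (f' := fun x => innerSL ℝ (G x)) (fun x hx => (hF x hx).hasFDerivAt)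
      (fun x hx x' hx' => by
        rw [← map_sub, innerSL_apply_norm]
        exact hlip x hx x' hx') hy hmem)).2
    simp only [innerSL_apply_apply] at this
    linarith
  have hvδ : β * ⟪v, y' - y⟫ ≤ -δ ^ 2 := by
    have h1 := hproj y hy
    have e : y - β • v - y' = -((y' - y) + β • v) := by abel
    rw [e, ← neg_sub y' y, inner_neg_neg, inner_add_left, real_inner_self_eq_norm_sq,
      inner_smul_left] at h1
    simp only [conj_trivial] at h1
    linarith
  have hvδ' : ⟪v, y' - y⟫ ≤ -(1 / β * δ ^ 2) := by
    rw [← mul_le_mul_iff_right₀ hβ]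
    refine hvδ.trans (le_of_eq ?_)
    field_simp
  have herr : -⟪v - G y, y' - y⟫ ≤ β * ε ^ 2 + 1 / (4 * β) * δ ^ 2 := by
    have h1 : -⟪v - G y, y' - y⟫ ≤ ε * δ :=
      (neg_le_abs _).trans ((abs_real_inner_le_norm _ _).trans (by gcongr))
    have h2 : β * ε ^ 2 + 1 / (4 * β) * δ ^ 2 - ε * δ = β * (ε - δ / (2 * β)) ^ 2 := by
      field_simp
      ring
    have h3 : 0 ≤ β * (ε - δ / (2 * β)) ^ 2 := by positivity
    linarith
  have hdec : 1 / (2 * β) * δ ^ 2 ≤ F y - F y' + β * ε ^ 2 := by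
    have h1 := mul_le_mul_of_nonneg_right hLβ (sq_nonneg δ)
    have h2 : 1 / (2 * β) * δ ^ 2 =
        1 / β * δ ^ 2 - 1 / (4 * β) * δ ^ 2 - 1 / (4 * β) * δ ^ 2 := by
      field_simp
      ring
    rw [inner_sub_left] at herr
    linarith
  -- the projection residual is a normal vector
  have hN : β⁻¹ • (y - y') - v ∈ normalCone C y' := fun w hw => by
    have h1 := hproj w hw
    have e : β⁻¹ • (y - y') - v = β⁻¹ • (y - β • v - y') := by
      rw [sub_right_comm, smul_sub β⁻¹ (y - y'), smul_smul, inv_mul_cancel₀ hβ.ne', one_smul]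
    rw [e, inner_smul_left]
    exact mul_nonpos_of_nonneg_of_nonpos (by simpa using hβ.le) h1
  have hdist : Metric.infDist (-G y') (normalCone C y') ≤ 2 / β * δ + ε := by
    refine (Metric.infDist_le_dist_of_mem hN).trans ?_
    have e : -G y' - (β⁻¹ • (y - y') - v) = β⁻¹ • (y' - y) + (v - G y) - (G y' - G y) := by
      rw [← neg_sub y' y, smul_neg]
      abel
    rw [dist_eq_norm, e]
    calc _ ≤ ‖β⁻¹ • (y' - y)‖ + ‖v - G y‖ + ‖G y' - G y‖ :=
          (norm_sub_le _ _).trans (by gcongr; exact norm_add_le _ _)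
      _ ≤ β⁻¹ * δ + ε + 1 / (4 * β) * δ := by
          rw [norm_smul, Real.norm_of_nonneg (inv_nonneg.2 hβ.le)]
          gcongr
          exact (hlip y' hmem y hy).trans (by gcongr)
      _ ≤ 2 / β * δ + ε := by
          have : 2 / β * δ - β⁻¹ * δ - 1 / (4 * β) * δ = 3 / (4 * β) * δ := by
            field_simp
            ring
          have : 0 ≤ 3 / (4 * β) * δ := by positivity
          linarith
  calc _ ≤ (2 / β * δ + ε) ^ 2 := pow_le_pow_left₀ Metric.infDist_nonneg hdist 2
    _ ≤ 2 * (2 / β * δ) ^ 2 + 2 * ε ^ 2 := by linarith [sq_nonneg (2 / β * δ - ε)]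
    _ = 16 / β * (1 / (2 * β) * δ ^ 2) + 2 * ε ^ 2 := by
        field_simp
        ring
    _ ≤ 16 / β * (F y - F y' + β * ε ^ 2) + 2 * ε ^ 2 := by gcongr
    _ = _ := by
        field_simp
        ring

end BilevelPMD

open BilevelPMD

theorem theorem2 :
    ∃ lam : ℝ → ℝ → ℝ, (∀ η α : ℝ, 0 < lam η α ∧ lam η α < 1) ∧
    ∀ (N : ℕ) (d : Fin N → ℕ) (m : ℕ) (C : Set (BilevelPMD.Upper m))
      (f g : BilevelPMD.Lower d → BilevelPMD.Upper m → ℝ)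
      (η Lf Ωf Lg Ωg τh ρh Λ τy ρy : ℝ),
      (∀ i, 0 < d i) → IsClosed C → Convex ℝ C → 0 < η →
      BilevelPMD.UpperAssumptions f C Lf Ωf →
      BilevelPMD.LowerAssumptions g C Lg Ωg τh ρh Λ τy ρy →
      BddBelow (BilevelPMD.objective f g η '' C) →
      (∀ y ∈ C, DifferentiableAt ℝ (BilevelPMD.objective f g η) y) ∧
      ∃ αbar βlow βbar : ℝ, 0 < αbar ∧ 0 < βlow ∧ βlow < βbar ∧
        ∀ α : ℝ, 0 < α → α ≤ αbar →
          ∃ (D₀ : ℕ) (c₂ : ℝ), ∀ y0 ∈ C, ∃ c₁ : ℝ,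
            ∀ h0 ∈ BilevelPMD.innerSimplices d Ωg η,
            ∀ β : ℝ, βlow ≤ β → β ≤ βbar →
            ∀ D : ℕ, D₀ ≤ D → ∀ K : ℕ, 1 ≤ K →
              (1 / (K : ℝ)) * ∑ k ∈ Finset.Icc 1 K,
                Metric.infDist
                  (-gradient (BilevelPMD.objective f g η)
                    (BilevelPMD.upperIter f g C η α β D y0 h0 k).1)
                  (BilevelPMD.normalCone C
                    (BilevelPMD.upperIter f g C η α β D y0 h0 k).1) ^ 2
              ≤ c₁ * (1 / (K : ℝ)) + c₂ * lam η α ^ D := by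
  classical
  -- The rate is `1 - η α / 2`; the default value `1 / 2` is never used for admissible step sizes.
  refine ⟨fun η α => if 0 < 1 - η * α / 2 ∧ 1 - η * α / 2 < 1 then 1 - η * α / 2 else 1 / 2,
    fun η α => ?_, ?_⟩
  · dsimp only
    split_ifs with h
    · exact h
    · norm_num
  intro N d m C f g η Lf Ωf Lg Ωg τh ρh Λ τy ρy hd hC hconv hη hf hg hbdd
  have hgrad : ∀ y ∈ C, HasGradientAt (objective f g η) (gradient (objective f g η) y) y :=
    fun y hy => (hasGradientAt_objective hf hg hd hη hy).differentiableAt.hasGradientAt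
  refine ⟨fun y hy => (hgrad y hy).differentiableAt, ?_⟩
  obtain ⟨L, hL, hlip⟩ := exists_lipschitz_gradient_objective hf hg hd hη hconv
  obtain ⟨b, hb⟩ := hbdd
  set M := max (2 * Ωg / η) (-Real.log (nuMin d Ωg η))
  have hM : 2 * Ωg / η ≤ M := le_max_left _ _
  -- The bound on `α` gives the contraction of the inner loop. The factor `4 (L + 1)` gives
  -- `4 β L ≤ 1` also when the Lipschitz constant `L` of `∇F` vanishes.
  refine ⟨1 / (η + 4 * |Lg|), 1 / (8 * (L + 1)), 1 / (4 * (L + 1)), by positivity, by positivity,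
    ?_, fun α hα hαbar => ?_⟩
  · gcongr
    norm_num
  have hαL : α * (η + 4 * |Lg|) ≤ 1 := (le_div_iff₀ (by positivity)).1 hαbar
  obtain ⟨κ, hκ, herr⟩ := exists_hyperGrad_error_le hf hg hd hη hM hα hαL
  have hηα : 0 < η * α := mul_pos hη hα
  have hηα1 : η * α ≤ 1 := by
    have : 0 ≤ α * (4 * |Lg|) := by positivity
    linarith
  -- The error bound holds from `D = 0` on: the factor `κ` absorbs the transient of the inner loop.
  refine ⟨0, 18 * κ ^ 2, fun y0 hy0 =>
    ⟨128 * (L + 1) * (objective f g η y0 - b), fun h0 hh0 β hβ1 hβ2 D _ K hK => ?_⟩⟩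
  dsimp only
  rw [if_pos ⟨by linarith, by linarith⟩]
  have hβ : 0 < β := lt_of_lt_of_le (by positivity) hβ1
  have hβL : 4 * β * L ≤ 1 := by
    rw [le_div_iff₀ (by positivity)] at hβ2
    linarith
  have hβinv : 16 / β ≤ 128 * (L + 1) := by
    rw [div_le_iff₀ hβ]
    rw [div_le_iff₀ (by positivity)] at hβ1
    linarith
  set u := upperIter f g C η α β D y0 h0 with hu
  have hmem : ∀ k, (u k).1 ∈ C ∧ (u k).2 ∈ core d M := fun k => by
    induction k with
    | zero => exact ⟨hy0, core_mono (le_max_right _ _) (innerSimplices_subset_core Ωg η hh0)⟩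
    | succ k ih =>
      exact ⟨(proj_spec hC hconv ⟨y0, hy0⟩ _).1,
        hg.lowerIter_mem_core hd hη hM hα.le hηα1 ih.1 ih.2 D⟩
  set ε := κ * √(1 - η * α / 2) ^ D with hε
  have hε2 : ε ^ 2 = κ ^ 2 * (1 - η * α / 2) ^ D := by
    rw [hε, mul_pow, ← pow_mul, mul_comm D, pow_mul, Real.sq_sqrt (by linarith)]
  have hstep : ∀ k, Metric.infDist (-gradient (objective f g η) (u (k + 1)).1)
      (normalCone C (u (k + 1)).1) ^ 2 ≤
      16 / β * (objective f g η (u k).1 - objective f g η (u (k + 1)).1) + 18 * ε ^ 2 := fun k =>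
    infDist_normalCone_sq_le hC hconv hL hβ hβL hgrad hlip (hmem k).1
      (herr _ (hmem k).1 _ (hmem k).2 D)
  have hsum : ∑ k ∈ Finset.Icc 1 K, Metric.infDist (-gradient (objective f g η) (u k).1)
      (normalCone C (u k).1) ^ 2 ≤
      128 * (L + 1) * (objective f g η y0 - b) + K * (18 * ε ^ 2) := by
    have e : Finset.Icc 1 K = Finset.Ico (0 + 1) (K + 1) := by
      ext k
      simp
    rw [e, ← Finset.sum_Ico_add' _ 0 K 1, Nat.Ico_zero_eq_range]
    refine (Finset.sum_le_sum fun k _ => hstep k).trans ?_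
    rw [Finset.sum_add_distrib, ← Finset.mul_sum, Finset.sum_range_sub', Finset.sum_const,
      Finset.card_range, nsmul_eq_mul]
    have h0K : b ≤ objective f g η (u K).1 := hb ⟨_, (hmem K).1, rfl⟩
    have h00 : b ≤ objective f g η y0 := hb ⟨_, hy0, rfl⟩
    refine add_le_add ?_ le_rfl
    calc _ ≤ 16 / β * (objective f g η y0 - b) := by
          gcongr
          exact le_rfl
      _ ≤ _ := mul_le_mul_of_nonneg_right hβinv (sub_nonneg.2 h00)
  have hK0 : (0 : ℝ) < K := by exact_mod_cast hK
  calc _ ≤ 1 / (K : ℝ) * (128 * (L + 1) * (objective f g η y0 - b) + K * (18 * ε ^ 2)) := by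
        gcongr
    _ = _ := by
        rw [hε2]
        field_simp
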